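/- Let $\mathcal H_A,\mathcal H_B$ be separable complex Hilbert spaces and let $G$ be a positive (semidefinite) self-adjoint operator on $\mathcal H_A$ with dense domain $\mathcal D(G)$, with positive square root $\sqrt G$, such that $\inf\{\|G\varphi\| : \varphi\in\mathcal D(G),\ \|\varphi\|=1\}=0$. **Definitions.** For a Hilbert space $\mathcal H'$, a linear operator $V:\mathcal D(\sqrt G)\to\mathcal H'$ is *$\sqrt G$-bounded* if there are $a,b\ge 0$ with $\|V\varphi\|^2\le a^2\|\varphi\|^2+b^2\|\sqrt G\varphi\|^2$ for all $\varphi\in\mathcal D(\sqrt G)$, and *$\sqrt G$-infinitesimal* if it is $\sqrt G$-bounded and the infimum of the admissible $b$ is $0$; write $\mathfrak B_G(\mathcal H_A,\mathcal H')$ and $\mathfrak B_G^0(\mathcal H_A,\mathcal H')$ for the sets of these operators. $\mathfrak T(\mathcal H)$ is the space of trace class operators with the trace norm $\|\cdot\|_1$, and $\mathfrak S(\mathcal H)$ is the set of states (positive operators of trace $1$). For a state $\rho=\sum_i|\varphi_i\rangle\langle\varphi_i|$ on $\mathcal H_A$, $\operatorname{Tr}G\rho=\sum_i\|\sqrt G\varphi_i\|^2$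 if all $\varphi_i$ lie in $\mathcal D(\sqrt G)$, and $\operatorname{Tr}G\rho=+\infty$ otherwise. $\mathfrak S_G(\mathcal H_A)$ is the set of states with $\operatorname{Tr}G\rho<\infty$ and $\mathfrak T_G(\mathcal H_A)$ is its linear span. For $V\in\mathfrak B_G(\mathcal H_A,\mathcal H')$ and $\rho\in\mathfrak S_G(\mathcal H_A)$ put $V\rho V^*=\sum_i|V\varphi_i\rangle\langle V\varphi_i|$, where $\rho=\sum_i|\varphi_i\rangle\langle\varphi_i|$ is any decomposition; by linearity $V\rho V^*$ is then defined for all $\rho\in\mathfrak T_G(\mathcal H_A)$. A linear map $\Phi:\mathfrak T_G(\mathcal H_A)\to\mathfrak T(\mathcal H_B)$ belongs to $\mathfrak F_G(A,B)$ (respectively $\mathfrak F_G^0(A,B)$) if there are a separable Hilbert space $\mathcal H_E$ and an operator $V$ in $\mathfrak B_G(\mathcal H_A,\mathcal H_B\otimes\mathcal H_E)$ (respectively in $\mathfrak B_G^0(\mathcal H_A,\mathcal H_B\otimes\mathcal H_E)$) such that $\Phi(\rho)=\operatorname{Tr}_E V\rho V^*$ for all $\rho\in\mathfrak T_G(\mathcal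 H_A)$. For a separable Hilbert space $\mathcal H_R\neq 0$ and a state $\omega$ on $\mathcal H_A\otimes\mathcal H_R$ with $\operatorname{Tr}G\omega_A<\infty$, $\omega_A=\operatorname{Tr}_R\omega$, the operator $\Phi\otimes\mathrm{Id}_R(\omega)$ is the trace class operator on $\mathcal H_B\otimes\mathcal H_R$ determined by $$(I\otimes\langle r|)\,\bigl[\Phi\otimes\mathrm{Id}_R(\omega)\bigr]\,(I\otimes|r'\rangle)=\Phi\bigl((I\otimes\langle r|)\,\omega\,(I\otimes|r'\rangle)\bigr)\qquad\text{for all } r,r'\in\mathcal H_R ,$$ and the energy-constrained diamond norm is $\|\Phi\|_{\diamond,E}^G=\sup\{\|\Phi\otimes\mathrm{Id}_R(\omega)\|_1 : \omega\in\mathfrak S(\mathcal H_A\otimes\mathcal H_R),\ \operatorname{Tr}G\omega_A\le E\}$, $E>0$. For a finite or countable family $\{V_k\}\subset\mathfrak B_G(\mathcal H_A,\mathcal H_B)$ put $$\|\{V_k\}\|_E^G=\sup\Bigl\{\sum_k\operatorname{Tr}V_k\rho V_k^* : \rho\in\mathfrak S(\mathcal H_A),\ \operatorname{Tr}G\rho\le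 E\Bigr\}\in[0,\infty].$$ **Statement.** Let $\Phi:\mathfrak T_G(\mathcal H_A)\to\mathfrak T(\mathcal H_B)$ be a linear map. (A) $\Phi$ belongs to $\mathfrak F_G(A,B)$ if and only if $$\Phi(\rho)=\sum_k V_k\rho V_k^*\quad\text{for all }\rho\in\mathfrak T_G(\mathcal H_A)\qquad(*)$$ (convergence in trace norm) for some finite or countable family $\{V_k\}\subset\mathfrak B_G(\mathcal H_A,\mathcal H_B)$ such that $\|\{V_k\}\|_E^G<\infty$ for some $E>0$. For every such family, and for every separable $\mathcal H_R\ne0$, the operator $\Phi\otimes\mathrm{Id}_R(\omega)$ exists and is unique for every state $\omega$ on $\mathcal H_A\otimes\mathcal H_R$ with $\operatorname{Tr}G\omega_A<\infty$, and $\|\{V_k\}\|_E^G=\|\Phi\|_{\diamond,E}^G<\infty$ for all $E>0$. (B) $\Phi$ belongs to $\mathfrak F_G^0(A,B)$ if and only if $(*)$ holds for some finite or countable family $\{V_k\}\subset\mathfrak B_G^0(\mathcal H_A,\mathcal H_B)$ such that $\|\{V_k\}\|_E^G=o(E)$ as $E\to+\infty$. -/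

import Mathlib

open scoped TensorProduct InnerProductSpace ENNReal
open Filter Topology InnerProductSpace

namespace ECD

section SquareRoot

variable {H : Type*} [NormedAddCommGroup H] [InnerProductSpace ℂ H] [CompleteSpace H]

/-- A positive (semidefinite) self-adjoint, in general unbounded, operator. Self-adjointness of a
partially defined operator includes density of its domain. -/
structure IsPosSelfAdjoint (G : H →ₗ.[ℂ] H) : Prop where
  selfAdjoint : IsSelfAdjoint G
  nonneg : ∀ x : G.domain, 0 ≤ (⟪(x : H), G x⟫_ℂ).re

/-- `S` is the positive self-adjoint square root of `G`: `S` is positive and self-adjoint and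
`S ∘ S = G`, including equality of the domains. -/
structure IsPosSqrt (G S : H →ₗ.[ℂ] H) : Prop where
  pos : IsPosSelfAdjoint S
  sq : ∀ x y : H, (x, y) ∈ G.graph ↔ ∃ z : H, (x, z) ∈ S.graph ∧ (z, y) ∈ S.graph

theorem norm_le_norm_add {G : H →ₗ.[ℂ] H} (hG : IsPosSelfAdjoint G) {x y : H}
    (hxy : (x, y) ∈ G.graph) : ‖x‖ ≤ ‖x + y‖ := by
  obtain ⟨u, rfl, rfl⟩ := (G.mem_graph_iff).1 hxy
  have h1 := hG.nonneg u
  have h2 : ‖(u : H)‖ ^ 2 ≤ (⟪(u : H), u + G u⟫_ℂ).re := by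
    rw [inner_add_right, Complex.add_re]
    have : (⟪(u : H), (u : H)⟫_ℂ).re = ‖(u : H)‖ ^ 2 := by
      have := inner_self_eq_norm_sq (𝕜 := ℂ) (u : H)
      simpa using this
    linarith
  have h3 : (⟪(u : H), u + G u⟫_ℂ).re ≤ ‖(u : H)‖ * ‖(u : H) + G u‖ :=
    (Complex.re_le_norm _).trans (norm_inner_le_norm _ _)
  by_cases h0 : ‖(u : H)‖ = 0
  · rw [h0]; positivity
  · have : 0 < ‖(u : H)‖ := lt_of_le_of_ne (norm_nonneg _) (Ne.symm h0)
    nlinarith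

theorem graph_of_inner {G : H →ₗ.[ℂ] H} (hG : IsSelfAdjoint G) {w v : H}
    (h : ∀ x : G.domain, ⟪v, (x : H)⟫_ℂ = ⟪w, G x⟫_ℂ) : (w, v) ∈ G.graph := by
  have hA : G.adjoint = G := hG
  have h1 : w ∈ G.adjoint.domain := LinearPMap.mem_adjoint_domain_of_exists w ⟨v, h⟩
  have h2 : G.adjoint ⟨w, h1⟩ = v := LinearPMap.adjoint_apply_eq hG.dense_domain ⟨w, h1⟩ h
  have h3 : (w, v) ∈ G.adjoint.graph := (LinearPMap.mem_graph_iff _).2 ⟨⟨w, h1⟩, rfl, h2⟩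
  rwa [hA] at h3

theorem exists_resolvent {G : H →ₗ.[ℂ] H} (hG : IsPosSelfAdjoint G) (h : H) :
    ∃ x y : H, (x, y) ∈ G.graph ∧ x + y = h := by
  have hclosed : IsClosed (G.graph : Set (H × H)) := hG.selfAdjoint.isClosed
  have : CompleteSpace G.graph := hclosed.completeSpace_coe
  let L : G.graph →L[ℂ] H :=
    (ContinuousLinearMap.fst ℂ H H + ContinuousLinearMap.snd ℂ H H).comp G.graph.subtypeL
  have hL : ∀ p : G.graph, L p = p.1.1 + p.1.2 := fun p => rfl
  have hanti : AntilipschitzWith 2 L := by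
    refine AddMonoidHomClass.antilipschitz_of_bound L (fun p => ?_)
    have h1 : ‖p.1.1‖ ≤ ‖L p‖ := norm_le_norm_add hG p.2
    have h2 : ‖p.1.2‖ ≤ 2 * ‖L p‖ := by
      have : p.1.2 = L p - p.1.1 := by rw [hL]; abel
      calc ‖p.1.2‖ ≤ ‖L p‖ + ‖p.1.1‖ := by rw [this]; exact norm_sub_le _ _
        _ ≤ 2 * ‖L p‖ := by linarith
    have h3 : ‖p‖ = max ‖p.1.1‖ ‖p.1.2‖ := rfl
    rw [h3]
    refine max_le (h1.trans ?_) (by simpa using h2)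
    have := norm_nonneg (L p)
    simp only [NNReal.coe_ofNat]
    linarith
  have hr : IsClosed (Set.range L) := hanti.isClosed_range L.uniformContinuous
  have : CompleteSpace (L.range) := by
    have : IsClosed ((L.range : Submodule ℂ H) : Set H) := hr
    exact this.completeSpace_coe
  have htop : L.range = ⊤ := by
    rw [← Submodule.orthogonal_eq_bot_iff, Submodule.eq_bot_iff]
    intro w hw
    rw [Submodule.mem_orthogonal'] at hw
    have hw' : ∀ x : G.domain, ⟪w, (x : H) + G x⟫_ℂ = 0 := fun x =>
      hw _ ⟨⟨((x : H), G x), G.mem_graph x⟩, rfl⟩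
    have hg : (w, -w) ∈ G.graph := graph_of_inner hG.selfAdjoint (fun x => by
      have := hw' x
      rw [inner_add_right] at this
      rw [inner_neg_left]
      linear_combination -this)
    have := norm_le_norm_add hG hg
    simpa using this
  have hh : h ∈ L.range := by rw [htop]; trivial
  obtain ⟨p, hp⟩ := hh
  exact ⟨p.1.1, p.1.2, p.2, hp⟩

/-- Every positive self-adjoint operator has a positive self-adjoint square root. -/
theorem exists_posSqrt {G : H →ₗ.[ℂ] H} (hG : IsPosSelfAdjoint G) :
    ∃ S : H →ₗ.[ℂ] H, IsPosSqrt G S := by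
  choose r g hrg hsum using exists_resolvent hG
  have huniq : ∀ {x y : H}, (x, y) ∈ G.graph → r (x + y) = x := by
    intro x y hxy
    have h1 := G.graph.sub_mem (hrg (x + y)) hxy
    have h2 := norm_le_norm_add hG h1
    have h3 : r (x + y) - x + (g (x + y) - y) = 0 := by
      rw [show r (x + y) - x + (g (x + y) - y) = (r (x + y) + g (x + y)) - (x + y) by abel,
        hsum, sub_self]
    have h4 : ‖r (x + y) - x‖ ≤ 0 := by
      have h5 : ‖r (x + y) - x‖ ≤ ‖r (x + y) - x + (g (x + y) - y)‖ := h2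
      rwa [h3, norm_zero] at h5
    exact sub_eq_zero.1 (norm_le_zero_iff.1 h4)
  let R : H →L[ℂ] H := LinearMap.mkContinuous
    { toFun := r
      map_add' := fun a b => by
        have := huniq (G.graph.add_mem (hrg a) (hrg b))
        rwa [show r a + r b + (g a + g b) = (r a + g a) + (r b + g b) by abel, hsum, hsum] at this
      map_smul' := fun c a => by
        have := huniq (G.graph.smul_mem c (hrg a))
        rwa [← smul_add, hsum] at this } 1 (fun a => by
          have := norm_le_norm_add hG (hrg a)
          rw [hsum] at this
          simpa using this)
  have hR : ∀ a, R a = r a := fun a => rfl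
  have hRg : ∀ a, (R a, a - R a) ∈ G.graph := fun a => by
    have h1 := hrg a
    have h2 : g a = a - R a := by rw [hR, eq_sub_iff_add_eq, add_comm, hsum]
    rwa [h2] at h1
  have hRu : ∀ {x y : H}, (x, y) ∈ G.graph → R (x + y) = x := huniq
  have hsymm : ∀ {x y x' y' : H}, (x, y) ∈ G.graph → (x', y') ∈ G.graph →
      ⟪y, x'⟫_ℂ = ⟪x, y'⟫_ℂ := by
    intro x y x' y' h h'
    obtain ⟨u, rfl, rfl⟩ := (G.mem_graph_iff).1 h
    obtain ⟨u', rfl, rfl⟩ := (G.mem_graph_iff).1 h'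
    have hfa := LinearPMap.adjoint_isFormalAdjoint hG.selfAdjoint.dense_domain
    have hA : G.adjoint = G := hG.selfAdjoint
    rw [hA] at hfa
    exact hfa u u'
  have hnn : ∀ {x y : H}, (x, y) ∈ G.graph → 0 ≤ (⟪x, y⟫_ℂ).re := by
    intro x y h
    obtain ⟨u, rfl, rfl⟩ := (G.mem_graph_iff).1 h
    exact hG.nonneg u
  have hRsymm : (R : H →ₗ[ℂ] H).IsSymmetric := by
    intro a b
    have h1 := hsymm (hRg a) (hRg b)
    rw [inner_sub_left, inner_sub_right] at h1
    change ⟪R a, b⟫_ℂ = ⟪a, R b⟫_ℂ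
    linear_combination -h1
  have hre : ∀ a : H, 0 ≤ (⟪a, a⟫_ℂ).re := fun a => inner_self_nonneg (𝕜 := ℂ)
  have hRpos : 0 ≤ R := by
    rw [ContinuousLinearMap.nonneg_iff_isPositive]
    refine ⟨hRsymm, fun a => ?_⟩
    change 0 ≤ (⟪R a, a⟫_ℂ).re
    have h1 := hnn (hRg a)
    rw [inner_sub_right, Complex.sub_re] at h1
    linarith [hre (R a)]
  have hR1 : 0 ≤ 1 - R := by
    rw [ContinuousLinearMap.nonneg_iff_isPositive]
    refine ⟨fun a b => ?_, fun a => ?_⟩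
    · change ⟪a - R a, b⟫_ℂ = ⟪a, b - R b⟫_ℂ
      rw [inner_sub_left, inner_sub_right]
      congr 1
      exact hRsymm a b
    · change 0 ≤ (⟪a - R a, a⟫_ℂ).re
      have h1 := hnn (hRg a)
      have h2 := hre (a - R a)
      have h3 : (⟪a - R a, a⟫_ℂ) = ⟪a - R a, a - R a⟫_ℂ + ⟪a - R a, R a⟫_ℂ := by
        rw [← inner_add_right, sub_add_cancel]
      have h4 : ⟪a - R a, R a⟫_ℂ = ⟪R a, a - R a⟫_ℂ := hsymm (hRg a) (hRg a)
      rw [h3, h4, Complex.add_re]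
      linarith
  let C : H →L[ℂ] H := CFC.sqrt R
  let D : H →L[ℂ] H := CFC.sqrt (1 - R)
  have hC0 : 0 ≤ C := CFC.sqrt_nonneg R
  have hD0 : 0 ≤ D := CFC.sqrt_nonneg (1 - R)
  have hCC : C * C = R := CFC.sqrt_mul_sqrt_self R hRpos
  have hDD : D * D = 1 - R := CFC.sqrt_mul_sqrt_self (1 - R) hR1
  have hcomm : Commute C D := by
    have h1 : Commute (1 - R) C :=
      ((Commute.one_left C).sub_left (by rw [← hCC]; exact (Commute.refl C).mul_left (Commute.refl C)))
    exact (Commute.cfcₙ_nnreal h1 NNReal.sqrt).symm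
  have hCD0 : 0 ≤ C * D := hcomm.mul_nonneg hC0 hD0
  have hCDx : ∀ a, C (D a) = D (C a) := fun a => DFunLike.congr_fun hcomm.eq a
  have hCCx : ∀ a, C (C a) = R a := fun a => DFunLike.congr_fun hCC a
  have hDDx : ∀ a, D (D a) = a - R a := fun a => DFunLike.congr_fun hDD a
  have hCs : ∀ a b, ⟪C a, b⟫_ℂ = ⟪a, C b⟫_ℂ :=
    ((ContinuousLinearMap.nonneg_iff_isPositive C).1 hC0).isSymmetric
  have hDs : ∀ a b, ⟪D a, b⟫_ℂ = ⟪a, D b⟫_ℂ :=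
    ((ContinuousLinearMap.nonneg_iff_isPositive D).1 hD0).isSymmetric
  have hRinj : ∀ a, R a = 0 → a = 0 := by
    intro a ha
    have h1 := hRg a
    rw [ha, sub_zero] at h1
    exact G.graph_fst_eq_zero_snd h1 rfl
  have hCinj : Function.Injective (C : H →ₗ[ℂ] H) := by
    rw [← LinearMap.ker_eq_bot, LinearMap.ker_eq_bot']
    intro a ha
    apply hRinj
    rw [← hCCx]
    change C a = 0 at ha
    rw [ha, map_zero]
  let e : H ≃ₗ[ℂ] LinearMap.range (C : H →ₗ[ℂ] H) := LinearEquiv.ofInjective _ hCinj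
  let S : H →ₗ.[ℂ] H :=
    { domain := LinearMap.range (C : H →ₗ[ℂ] H)
      toFun := (D : H →ₗ[ℂ] H).comp (e.symm : LinearMap.range (C : H →ₗ[ℂ] H) →ₗ[ℂ] H) }
  have he : ∀ a, ((e a : LinearMap.range (C : H →ₗ[ℂ] H)) : H) = C a := fun a => rfl
  have hSe : ∀ a, S (e a) = D a := fun a => by
    change D (e.symm (e a)) = D a
    rw [e.symm_apply_apply]
  have hSg : ∀ {u v : H}, (u, v) ∈ S.graph ↔ ∃ a, C a = u ∧ D a = v := by
    intro u v
    rw [LinearPMap.mem_graph_iff]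
    constructor
    · rintro ⟨p, hp1, hp2⟩
      obtain ⟨a, rfl⟩ := e.surjective p
      exact ⟨a, hp1, (hSe a).symm.trans hp2⟩
    · rintro ⟨a, rfl, rfl⟩
      exact ⟨e a, he a, hSe a⟩
  have hSd : Dense (S.domain : Set H) := by
    rw [Submodule.dense_iff_topologicalClosure_eq_top, Submodule.topologicalClosure_eq_top_iff,
      Submodule.eq_bot_iff]
    intro w hw
    rw [Submodule.mem_orthogonal] at hw
    apply hCinj
    rw [map_zero]
    change C w = 0
    rw [← inner_self_eq_zero (𝕜 := ℂ), ← hCs]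
    exact hw _ ⟨C w, rfl⟩
  have hSsa : IsSelfAdjoint S := by
    rw [LinearPMap.isSelfAdjoint_def]
    apply le_antisymm
    · apply LinearPMap.le_of_le_graph
      rintro ⟨y, z⟩ hyz
      obtain ⟨p, hp1, hp2⟩ := (LinearPMap.mem_graph_iff _).1 hyz
      simp only at hp1 hp2
      have h1 : ∀ a, ⟪z, C a⟫_ℂ = ⟪y, D a⟫_ℂ := fun a => by
        have := LinearPMap.adjoint_isFormalAdjoint hSd p (e a)
        rw [hp1, hp2, hSe, he] at this
        exact this
      have h2 : C z = D y := by
        apply ext_inner_right ℂ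
        intro a
        rw [hCs, hDs, h1]
      refine hSg.2 ⟨C y + D z, ?_, ?_⟩
      · rw [map_add, hCCx, hCDx, h2, hDDx]; abel
      · rw [map_add, ← hCDx, ← h2, hCCx, hDDx]; abel
    · apply LinearPMap.IsFormalAdjoint.le_adjoint hSd
      intro p q
      obtain ⟨a, rfl⟩ := e.surjective p
      obtain ⟨b, rfl⟩ := e.surjective q
      rw [hSe, hSe, he, he, hDs, ← hCDx, hCs]
  refine ⟨S, ⟨hSsa, ?_⟩, ?_⟩
  · intro p
    obtain ⟨a, rfl⟩ := e.surjective p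
    rw [hSe, he, hCs]
    have := ((ContinuousLinearMap.nonneg_iff_isPositive _).1 hCD0).re_inner_nonneg_right a
    exact this
  · intro x y
    constructor
    · intro hxy
      have hx := hRu hxy
      refine ⟨D (C (x + y)), hSg.2 ⟨C (x + y), ?_, rfl⟩, hSg.2 ⟨D (x + y), hCDx _, ?_⟩⟩
      · rw [hCCx, hx]
      · rw [hDDx, hx]; abel
    · rintro ⟨z, h1, h2⟩
      obtain ⟨u, rfl, rfl⟩ := hSg.1 h1
      obtain ⟨v, h3, rfl⟩ := hSg.1 h2
      have h4 : C (C u + D v) = u := by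
        rw [map_add, hCCx, hCDx, h3, hDDx]; abel
      have h5 : R (C u + D v) = C u := by rw [← hCCx, h4]
      have h6 := hRg (C u + D v)
      rwa [h5, add_sub_cancel_left] at h6

end SquareRoot

section Definitions

universe u v w

variable {H : Type u} [NormedAddCommGroup H] [InnerProductSpace ℂ H] [CompleteSpace H]
variable {K : Type v} [NormedAddCommGroup K] [InnerProductSpace ℂ K] [CompleteSpace K]

/-- The positive self-adjoint square root `√G` of a positive self-adjoint operator `G`. -/
noncomputable def sqrtOp (G : H →ₗ.[ℂ] H) : H →ₗ.[ℂ] H :=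
  Classical.epsilon (IsPosSqrt G)

theorem sqrtOp_spec {G : H →ₗ.[ℂ] H} (hG : IsPosSelfAdjoint G) : IsPosSqrt G (sqrtOp G) :=
  Classical.epsilon_spec (exists_posSqrt hG)

/-- The condition `inf {‖G φ‖ : φ ∈ D(G), ‖φ‖ = 1} = 0`. -/
def HasZeroInf (G : H →ₗ.[ℂ] H) : Prop :=
  IsGLB {t : ℝ | ∃ x : G.domain, ‖(x : H)‖ = 1 ∧ ‖G x‖ = t} 0

/-! ### Relatively bounded operators

Operators are identified when they coincide on `D(√G)`, so an operator whose domain contains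
`D(√G)` is a linear map on `D(√G)`. -/

/-- `‖V φ‖² ≤ a² ‖φ‖² + b² ‖√G φ‖²` for all `φ ∈ D(√G)`. -/
def HasRelBound (G : H →ₗ.[ℂ] H) (V : (sqrtOp G).domain →ₗ[ℂ] K) (a b : ℝ) : Prop :=
  ∀ φ : (sqrtOp G).domain,
    ‖V φ‖ ^ 2 ≤ a ^ 2 * ‖(φ : H)‖ ^ 2 + b ^ 2 * ‖sqrtOp G φ‖ ^ 2

/-- `√G`-bounded operators. -/
def IsRelBounded (G : H →ₗ.[ℂ] H) (V : (sqrtOp G).domain →ₗ[ℂ] K) : Prop :=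
  ∃ a b : ℝ, 0 ≤ a ∧ 0 ≤ b ∧ HasRelBound G V a b

/-- The `√G`-bound of an operator. -/
noncomputable def relBound (G : H →ₗ.[ℂ] H) (V : (sqrtOp G).domain →ₗ[ℂ] K) : ℝ :=
  sInf {b : ℝ | 0 ≤ b ∧ ∃ a : ℝ, 0 ≤ a ∧ HasRelBound G V a b}

/-- `√G`-infinitesimal operators. -/
def IsRelInfinitesimal (G : H →ₗ.[ℂ] H) (V : (sqrtOp G).domain →ₗ[ℂ] K) : Prop :=
  IsRelBounded G V ∧ relBound G V = 0

/-! ### Trace norm, trace and states -/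

/-- The trace norm `‖T‖₁ = sup ∑ᵢ |⟨fᵢ, T eᵢ⟩|`, the supremum being over all finite orthonormal
families `(eᵢ)`, `(fᵢ)` of equal length. -/
noncomputable def traceNorm (T : H →L[ℂ] K) : ℝ≥0∞ :=
  ⨆ (n : ℕ) (e : Fin n → H) (f : Fin n → K) (_ : Orthonormal ℂ e) (_ : Orthonormal ℂ f),
    ∑ i, ‖⟪f i, T (e i)⟫_ℂ‖ₑ

theorem traceNorm_le_iff {H : Type u} [NormedAddCommGroup H] [InnerProductSpace ℂ H]
    {K : Type v} [NormedAddCommGroup K] [InnerProductSpace ℂ K] {T : H →L[ℂ] K} {c : ℝ≥0∞} : traceNorm T ≤ c ↔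
    ∀ (n : ℕ) (e : Fin n → H) (f : Fin n → K), Orthonormal ℂ e → Orthonormal ℂ f →
      ∑ i, ‖⟪f i, T (e i)⟫_ℂ‖ₑ ≤ c := by
  simp only [traceNorm, iSup_le_iff]

variable (H) in
/-- The space of trace class operators on `H`. -/
def traceClass : Submodule ℂ (H →L[ℂ] H) where
  carrier := {T | traceNorm T < ⊤}
  zero_mem' := by
    have : traceNorm (0 : H →L[ℂ] H) ≤ 0 := traceNorm_le_iff.2 (by simp)
    exact this.trans_lt ENNReal.zero_lt_top
  add_mem' := by
    intro S T hS hT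
    refine lt_of_le_of_lt (traceNorm_le_iff.2 fun n e f he hf => ?_) (ENNReal.add_lt_top.2 ⟨hS, hT⟩)
    refine le_trans ?_ (add_le_add (traceNorm_le_iff.1 le_rfl n e f he hf)
      (traceNorm_le_iff.1 le_rfl n e f he hf))
    rw [← Finset.sum_add_distrib]
    refine Finset.sum_le_sum fun i _ => ?_
    rw [add_apply, inner_add_right]
    exact enorm_add_le _ _
  smul_mem' := by
    intro c T hT
    refine lt_of_le_of_lt (traceNorm_le_iff.2 fun n e f he hf => ?_)
      (ENNReal.mul_lt_top (enorm_lt_top (x := c)) hT)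
    refine le_trans (le_of_eq ?_) (mul_le_mul_right (traceNorm_le_iff.1 le_rfl n e f he hf) ‖c‖ₑ)
    rw [Finset.mul_sum]
    refine Finset.sum_congr rfl fun i _ => ?_
    rw [smul_apply, inner_smul_right, enorm_mul]

variable (H) in
/-- The index set of some fixed orthonormal basis of `H`. -/
def BasisIndex : Set H := (exists_hilbertBasis ℂ H).choose

variable (H) in
/-- Some fixed orthonormal basis of `H`. -/
noncomputable def onb : HilbertBasis (BasisIndex H) ℂ H :=
  (exists_hilbertBasis ℂ H).choose_spec.choose

/-- The trace of a positive operator, with values in `[0, ∞]`. It does not depend on the basis. -/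
noncomputable def posTrace (T : H →L[ℂ] H) : ℝ≥0∞ :=
  ∑' i, ENNReal.ofReal (⟪onb H i, T (onb H i)⟫_ℂ).re

/-- States (density operators): positive operators with unit trace. -/
def IsState (ρ : H →L[ℂ] H) : Prop := ρ.IsPositive ∧ posTrace ρ = 1

/-- The energy `Tr Gρ ∈ [0, ∞]` of a positive trace class operator `ρ`: the trace of the positive
quadratic form `√G ρ √G` on `D(√G)`, i.e. the supremum of `∑ᵢ ⟨√G fᵢ, ρ √G fᵢ⟩` over all finite
orthonormal families `(fᵢ)` in `D(√G)`. If `ρ = ∑ᵢ |φᵢ⟩⟨φᵢ|` with all `φᵢ` in `D(√G)`, this is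
`∑ᵢ ‖√G φᵢ‖²`, and it is equal to `supₙ Tr Pₙ G ρ` for the spectral projections `Pₙ` of `G` that
correspond to `[0, n]`. -/
noncomputable def energy (G : H →ₗ.[ℂ] H) (ρ : H →L[ℂ] H) : ℝ≥0∞ :=
  ⨆ (n : ℕ) (f : Fin n → (sqrtOp G).domain) (_ : Orthonormal ℂ (fun i => (f i : H))),
    ∑ i, ENNReal.ofReal (⟪sqrtOp G (f i), ρ (sqrtOp G (f i))⟫_ℂ).re

/-- The set `𝔖_G(H)` of states with finite energy. -/
def finiteEnergyStates (G : H →ₗ.[ℂ] H) : Set (H →L[ℂ] H) :=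
  {ρ | IsState ρ ∧ energy G ρ < ⊤}

/-- The linear span `𝔗_G(H)` of the states with finite energy. -/
def finiteEnergySpan (G : H →ₗ.[ℂ] H) : Submodule ℂ (H →L[ℂ] H) :=
  Submodule.span ℂ (finiteEnergyStates G)

/-! ### The operators `V ρ V*` -/

/-- `ρ = ∑ᵢ |φᵢ⟩⟨φᵢ|` with `φᵢ ∈ D(√G)`. For `ρ` of finite energy, the vectors of any decomposition
of `ρ` lie in `D(√G)`. A finite decomposition is filled up with zeros. -/
def IsDecomposition (G : H →ₗ.[ℂ] H) (ρ : H →L[ℂ] H) (φ : ℕ → (sqrtOp G).domain) : Prop :=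
  HasSum (fun i => rankOne ℂ (φ i : H) (φ i : H)) ρ

/-- `T = ∑ᵢ |V φᵢ⟩⟨V φᵢ|` for any decomposition `ρ = ∑ᵢ |φᵢ⟩⟨φᵢ|`. -/
def IsSandwich (G : H →ₗ.[ℂ] H) (V : (sqrtOp G).domain →ₗ[ℂ] K) (ρ : H →L[ℂ] H)
    (T : K →L[ℂ] K) : Prop :=
  (∃ φ, IsDecomposition G ρ φ) ∧
    ∀ φ, IsDecomposition G ρ φ → HasSum (fun i => rankOne ℂ (V (φ i)) (V (φ i))) T

/-- The operator `V ρ V*`, for a `√G`-bounded `V` and a positive trace class operator `ρ` of finite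
energy. -/
noncomputable def sandwich (G : H →ₗ.[ℂ] H) (V : (sqrtOp G).domain →ₗ[ℂ] K) (ρ : H →L[ℂ] H) :
    K →L[ℂ] K :=
  Classical.epsilon (IsSandwich G V ρ)

/-! ### Tensor products and partial traces -/

/-- The Hilbert space tensor product. -/
abbrev HTensor (H : Type u) (R : Type w) [NormedAddCommGroup H] [InnerProductSpace ℂ H]
    [NormedAddCommGroup R] [InnerProductSpace ℂ R] : Type (max u w) :=
  UniformSpace.Completion (H ⊗[ℂ] R)

variable {R : Type w} [NormedAddCommGroup R] [InnerProductSpace ℂ R] [CompleteSpace R]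

/-- The operator `I ⊗ |r⟩ : φ ↦ φ ⊗ r` from `H` to `H ⊗ R`. -/
noncomputable def tensorRight (H : Type u) [NormedAddCommGroup H] [InnerProductSpace ℂ H]
    (r : R) : H →L[ℂ] HTensor H R :=
  (UniformSpace.Completion.toComplL (𝕜 := ℂ) (E := H ⊗[ℂ] R)).comp
    ((TensorProduct.mkL ℂ H R).flip r)

/-- The operator `(I ⊗ ⟨r|) ω (I ⊗ |r'⟩)` on `H`, for an operator `ω` on `H ⊗ R`. -/
noncomputable def slice (ω : HTensor H R →L[ℂ] HTensor H R) (r r' : R) : H →L[ℂ] H :=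
  (ContinuousLinearMap.adjoint (tensorRight H r)).comp (ω.comp (tensorRight H r'))

/-- The partial trace over the second factor of a trace class operator on `H ⊗ R`: the sum of
`(I ⊗ ⟨eᵢ|) ω (I ⊗ |eᵢ⟩)` over an orthonormal basis `(eᵢ)` of `R`. For trace class `ω` the series
converges absolutely and its sum does not depend on the basis. -/
noncomputable def partialTrace (ω : HTensor H R →L[ℂ] HTensor H R) : H →L[ℂ] H :=
  ∑' i, slice ω (onb R i) (onb R i)

/-! ### The cones of maps, Kraus representations and the energy-constrained diamond norm -/

/-- A linear map `Φ : 𝔗_G(H) → 𝔗(K)`. -/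
abbrev EnergyMap (G : H →ₗ.[ℂ] H) (K : Type v) [NormedAddCommGroup K] [InnerProductSpace ℂ K]
    [CompleteSpace K] :=
  finiteEnergySpan G →ₗ[ℂ] traceClass K

/-- `Φ(ρ) = Tr_E V ρ V*` on the states of finite energy, hence, by linearity, on `𝔗_G(H)`. -/
def IsRepresenting (G : H →ₗ.[ℂ] H) (Φ : EnergyMap G K) {L : Type w} [NormedAddCommGroup L]
    [InnerProductSpace ℂ L] [CompleteSpace L] (V : (sqrtOp G).domain →ₗ[ℂ] HTensor K L) : Prop :=
  ∀ (ρ : H →L[ℂ] H) (hρ : ρ ∈ finiteEnergyStates G),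
    (Φ ⟨ρ, Submodule.subset_span hρ⟩ : K →L[ℂ] K) = partialTrace (sandwich G V ρ)

/-- The cone `𝔉_G`. Every separable Hilbert space is isometric to one in `Type`. -/
def InCone (G : H →ₗ.[ℂ] H) (Φ : EnergyMap G K) : Prop :=
  ∃ (L : Type) (_ : NormedAddCommGroup L) (_ : InnerProductSpace ℂ L) (_ : CompleteSpace L)
    (_ : TopologicalSpace.SeparableSpace L) (V : (sqrtOp G).domain →ₗ[ℂ] HTensor K L),
    IsRelBounded G V ∧ IsRepresenting G Φ V

/-- The cone `𝔉_G⁰`. -/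
def InConeZero (G : H →ₗ.[ℂ] H) (Φ : EnergyMap G K) : Prop :=
  ∃ (L : Type) (_ : NormedAddCommGroup L) (_ : InnerProductSpace ℂ L) (_ : CompleteSpace L)
    (_ : TopologicalSpace.SeparableSpace L) (V : (sqrtOp G).domain →ₗ[ℂ] HTensor K L),
    IsRelInfinitesimal G V ∧ IsRepresenting G Φ V

/-- `Φ(ρ) = ∑ₖ Vₖ ρ Vₖ*` on the states of finite energy, hence, by linearity, on `𝔗_G(H)`. The
series converges in trace norm. -/
def IsKraus (G : H →ₗ.[ℂ] H) (Φ : EnergyMap G K) {κ : Type}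
    (V : κ → (sqrtOp G).domain →ₗ[ℂ] K) : Prop :=
  ∀ (ρ : H →L[ℂ] H) (hρ : ρ ∈ finiteEnergyStates G),
    Tendsto (fun s : Finset κ =>
      traceNorm ((Φ ⟨ρ, Submodule.subset_span hρ⟩ : K →L[ℂ] K) - ∑ k ∈ s, sandwich G (V k) ρ))
      atTop (𝓝 0)

/-- The supremum of `∑ₖ Tr Vₖ ρ Vₖ*` over all states `ρ` with `Tr Gρ ≤ E`. -/
noncomputable def krausNorm (G : H →ₗ.[ℂ] H) {κ : Type} (V : κ → (sqrtOp G).domain →ₗ[ℂ] K)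
    (E : ℝ) : ℝ≥0∞ :=
  ⨆ (ρ : H →L[ℂ] H) (_ : IsState ρ) (_ : energy G ρ ≤ ENNReal.ofReal E),
    ∑' k, posTrace (sandwich G (V k) ρ)

/-- `T` is the value of `Φ ⊗ Id_R` at `ω`:
`(I ⊗ ⟨r|) T (I ⊗ |r'⟩) = Φ((I ⊗ ⟨r|) ω (I ⊗ |r'⟩))` for all `r, r' ∈ R`. -/
def IsAmplification (G : H →ₗ.[ℂ] H) (Φ : EnergyMap G K)
    (ω : HTensor H R →L[ℂ] HTensor H R) (T : HTensor K R →L[ℂ] HTensor K R) : Prop :=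
  T ∈ traceClass (HTensor K R) ∧
    ∀ r r' : R, ∃ h : slice ω r r' ∈ finiteEnergySpan G,
      slice T r r' = (Φ ⟨slice ω r r', h⟩ : K →L[ℂ] K)

/-- The operator `(Φ ⊗ Id_R)(ω)`. -/
noncomputable def amplify (G : H →ₗ.[ℂ] H) (Φ : EnergyMap G K)
    (ω : HTensor H R →L[ℂ] HTensor H R) : HTensor K R →L[ℂ] HTensor K R :=
  Classical.epsilon (IsAmplification G Φ ω)

/-- The energy-constrained diamond norm: the supremum of `‖(Φ ⊗ Id_R)(ω)‖₁` over all states `ω` on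
`H ⊗ R` with `Tr G ω_H ≤ E`, where `ω_H = Tr_R ω`. -/
noncomputable def ecdNorm (G : H →ₗ.[ℂ] H) (Φ : EnergyMap G K) (R : Type w)
    [NormedAddCommGroup R] [InnerProductSpace ℂ R] [CompleteSpace R] (E : ℝ) : ℝ≥0∞ :=
  ⨆ (ω : HTensor H R →L[ℂ] HTensor H R) (_ : IsState ω)
    (_ : energy G (partialTrace ω) ≤ ENNReal.ofReal E), traceNorm (amplify G Φ ω)

end Definitions

end ECD

open ECD

/-!
Every positive operator `ρ` of finite trace is a sum `∑ᵢ |φᵢ⟩⟨φᵢ|` (take `φᵢ = √ρ eᵢ`), and for such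
a sum the trace and the trace norm are both `∑ᵢ ‖φᵢ‖²` (`posTrace_of_hasSum`,
`traceNorm_of_hasSum`). If the energy is finite, then `φᵢ ∈ D(√G)` and the energy is `∑ᵢ ‖√G φᵢ‖²`
(`mem_domain_of_energy_ne_top`, `energy_of_hasSum`). So all quantities in the theorem become sums of
squared norms with values in `[0, ∞]`, which may be rearranged freely.

The map `x ↦ x + √G x` is a bijection of `D(√G)` onto the whole space, and a `√G`-bounded `V`
becomes the bounded operator `W = V (1 + √G)⁻¹`. A positive operator `ρ` of finite trace and energy
is `(1 + √G)⁻¹ σ (1 + √G)⁻¹` with a unique `σ`, and `V ρ V* = W σ W*`; hence `V ρ V*` does not depend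
on the decomposition of `ρ` (`hasSum_sandwich`).

Mixing a state with a pure state of almost zero energy, which exists by `HasZeroInf`, shows that the
Kraus norm `f` satisfies `f E' ≤ (2 E' / E) f E` for `E ≤ E'` (`ofReal_mul_krausNorm_le`). So it is
finite everywhere when it is finite somewhere, and
`∑ₖ ‖Vₖ φ‖² ≤ f E ‖φ‖² + (2 f E / E) ‖√G φ‖²` for every `E > 0` (`tsum_enorm_sq_le_add`).

With an orthonormal basis `(eₖ)` of the environment, `V φ = ∑ₖ Vₖ φ ⊗ eₖ` translates between
Stinespring operators and Kraus families, with `‖V φ‖² = ∑ₖ ‖Vₖ φ‖²`. The last bound turns a Kraus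
family into a `√G`-bounded `V`, and into a `√G`-infinitesimal one if `f E = o(E)`; conversely
`f E ≤ a² + b² E` for every admissible pair `(a, b)` of `V` (`inCone_iff`, `inConeZero_iff`).

At `ω = ∑ₙ |Ωₙ⟩⟨Ωₙ|` the amplification is `∑ₖₙ |(Vₖ ⊗ I) Ωₙ⟩⟨(Vₖ ⊗ I) Ωₙ|`
(`exists_isAmplification`). It is positive, so its trace norm is its trace, which is the Kraus
functional at the reduced state; every state is the reduced state of a product state, and the two
suprema agree (`krausNorm_eq_ecdNorm`).
-/

/-! ### Positive operators as sums of rank-one operators -/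

namespace ECD

section Outer

variable {H : Type*} [NormedAddCommGroup H] [InnerProductSpace ℂ H]
variable {K : Type*} [NormedAddCommGroup K] [InnerProductSpace ℂ K]
variable {ι : Type*}

theorem enorm_sq_eq_ofReal {E : Type*} [SeminormedAddCommGroup E] (x : E) :
    ‖x‖ₑ ^ 2 = ENNReal.ofReal (‖x‖ ^ 2) := by
  rw [← ofReal_norm, ENNReal.ofReal_pow (norm_nonneg _)]

theorem tsum_enorm_sq_ne_top_iff {E : Type*} [SeminormedAddCommGroup E] {ψ : ι → E} :
    ∑' i, ‖ψ i‖ₑ ^ 2 ≠ ⊤ ↔ Summable fun i => ‖ψ i‖ ^ 2 := by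
  simp only [enorm_sq_eq_ofReal]
  exact ⟨fun h => by
    simpa [ENNReal.toReal_ofReal, sq_nonneg] using ENNReal.summable_toReal h,
    fun h => h.tsum_ofReal_ne_top⟩

/-- A square-summable family `(ψᵢ)` defines the positive operator `∑ᵢ |ψᵢ⟩⟨ψᵢ|`. -/
theorem summable_rankOne [CompleteSpace H] {ψ : ι → H} (h : ∑' i, ‖ψ i‖ₑ ^ 2 ≠ ⊤) :
    Summable fun i => rankOne ℂ (ψ i) (ψ i) := by
  refine Summable.of_norm ?_
  simpa [← sq] using tsum_enorm_sq_ne_top_iff.1 h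

theorem ofReal_re_inner_of_hasSum {ψ : ι → H} {ρ : H →L[ℂ] H}
    (h : HasSum (fun i => rankOne ℂ (ψ i) (ψ i)) ρ) (x : H) :
    ENNReal.ofReal (⟪x, ρ x⟫_ℂ).re = ∑' i, ‖⟪x, ψ i⟫_ℂ‖ₑ ^ 2 := by
  have h1 := ((h.mapL (ContinuousLinearMap.apply ℂ H x)).mapL (innerSL ℂ x)).mapL Complex.reCLM
  have h2 : ∀ i, Complex.reCLM (innerSL ℂ x (ContinuousLinearMap.apply ℂ H x
      (rankOne ℂ (ψ i) (ψ i)))) = ‖⟪x, ψ i⟫_ℂ‖ ^ 2 := by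
    intro i
    simp only [ContinuousLinearMap.apply_apply, rankOne_apply, innerSL_apply_apply,
      inner_smul_right, Complex.reCLM_apply]
    rw [← inner_conj_symm (ψ i) x, mul_comm, Complex.mul_conj, Complex.normSq_eq_norm_sq,
      Complex.ofReal_re]
  simp only [h2] at h1
  simp only [enorm_sq_eq_ofReal]
  rw [← ENNReal.ofReal_tsum_of_nonneg (fun i => sq_nonneg _) h1.summable, h1.tsum_eq]
  rfl

theorem isPositive_of_hasSum [CompleteSpace H] {ψ : ι → H} {ρ : H →L[ℂ] H}
    (h : HasSum (fun i => rankOne ℂ (ψ i) (ψ i)) ρ) : ρ.IsPositive := by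
  rw [← ContinuousLinearMap.nonneg_iff_isPositive]
  exact h.nonneg fun i =>
    (ContinuousLinearMap.nonneg_iff_isPositive _).2 (isPositive_rankOne_self (ψ i))

theorem tsum_enorm_inner_sq_le {e : ι → H} (he : Orthonormal ℂ e) (x : H) :
    ∑' i, ‖⟪e i, x⟫_ℂ‖ₑ ^ 2 ≤ ‖x‖ₑ ^ 2 := by
  simp only [enorm_sq_eq_ofReal]
  rw [← ENNReal.ofReal_tsum_of_nonneg (fun i => sq_nonneg _) (he.inner_products_summable x)]
  exact ENNReal.ofReal_le_ofReal (he.tsum_inner_products_le x)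

theorem tsum_enorm_inner_sq_eq [CompleteSpace H] (e : HilbertBasis ι ℂ H) (x : H) :
    ∑' i, ‖⟪e i, x⟫_ℂ‖ₑ ^ 2 = ‖x‖ₑ ^ 2 := by
  have h1 := (e.hasSum_inner_mul_inner x x).mapL Complex.reCLM
  have h2 : ∀ i, Complex.reCLM (⟪x, e i⟫_ℂ * ⟪e i, x⟫_ℂ) = ‖⟪e i, x⟫_ℂ‖ ^ 2 := by
    intro i
    rw [← inner_conj_symm x (e i), mul_comm, Complex.mul_conj, Complex.normSq_eq_norm_sq,
      Complex.reCLM_apply, Complex.ofReal_re]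
  simp only [h2] at h1
  simp only [enorm_sq_eq_ofReal]
  rw [← ENNReal.ofReal_tsum_of_nonneg (fun i => sq_nonneg _) h1.summable, h1.tsum_eq]
  congr 1
  exact inner_self_eq_norm_sq (𝕜 := ℂ) x

theorem posTrace_of_hasSum [CompleteSpace H] {ψ : ι → H} {ρ : H →L[ℂ] H}
    (h : HasSum (fun i => rankOne ℂ (ψ i) (ψ i)) ρ) : posTrace ρ = ∑' i, ‖ψ i‖ₑ ^ 2 := by
  simp only [posTrace, ofReal_re_inner_of_hasSum h]
  rw [ENNReal.tsum_comm]
  simp only [tsum_enorm_inner_sq_eq]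

/-- The Cauchy–Schwarz inequality of a positive form, in its arithmetic-mean version. -/
theorem enorm_inner_le_of_isPositive [CompleteSpace H] {ρ : H →L[ℂ] H} (hρ : ρ.IsPositive)
    (x y : H) :
    2 * ‖⟪x, ρ y⟫_ℂ‖ₑ ≤
      ENNReal.ofReal (⟪x, ρ x⟫_ℂ).re + ENNReal.ofReal (⟪y, ρ y⟫_ℂ).re := by
  have hx : 0 ≤ (⟪x, ρ x⟫_ℂ).re := hρ.re_inner_nonneg_right x
  have hy : 0 ≤ (⟪y, ρ y⟫_ℂ).re := hρ.re_inner_nonneg_right y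
  rw [← ENNReal.ofReal_add hx hy, ← ofReal_norm,
    show (2 : ℝ≥0∞) = ENNReal.ofReal 2 by simp, ← ENNReal.ofReal_mul (by norm_num)]
  refine ENNReal.ofReal_le_ofReal ?_
  -- positivity of the form at `c • x - y`, where the phase `c` makes `⟪x, ρ y⟫` real
  obtain ⟨c, hc1, hc2⟩ : ∃ c : ℂ, ‖c‖ = 1 ∧ c * ⟪x, ρ y⟫_ℂ = ‖⟪x, ρ y⟫_ℂ‖ := by
    by_cases h0 : ⟪x, ρ y⟫_ℂ = 0
    · exact ⟨1, by simp, by simp [h0]⟩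
    · have hn : (‖⟪x, ρ y⟫_ℂ‖ : ℂ) ≠ 0 := by simpa using h0
      exact ⟨‖⟪x, ρ y⟫_ℂ‖ / ⟪x, ρ y⟫_ℂ, by simp [h0], by field_simp⟩
  have h := hρ.re_inner_nonneg_right ((starRingEnd ℂ c) • x - y)
  have hsym : ⟪y, ρ x⟫_ℂ = starRingEnd ℂ ⟪x, ρ y⟫_ℂ := by
    rw [inner_conj_symm]; exact (hρ.isSymmetric y x).symm
  simp only [map_sub, map_smul, inner_sub_left, inner_sub_right, inner_smul_left,
    inner_smul_right, Complex.conj_conj, hsym] at h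
  rw [hc2] at h
  have h2 : starRingEnd ℂ c * starRingEnd ℂ ⟪x, ρ y⟫_ℂ = ‖⟪x, ρ y⟫_ℂ‖ := by
    rw [← map_mul, hc2, Complex.conj_ofReal]
  rw [mul_sub, h2, ← mul_assoc, mul_comm _ c, Complex.mul_conj, Complex.normSq_eq_norm_sq, hc1] at h
  simp at h
  linarith

/-- The trace norm of a positive operator is its trace. -/
theorem traceNorm_of_hasSum [CompleteSpace H] {ψ : ι → H} {ρ : H →L[ℂ] H}
    (h : HasSum (fun i => rankOne ℂ (ψ i) (ψ i)) ρ) : traceNorm ρ = ∑' i, ‖ψ i‖ₑ ^ 2 := by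
  have hle : ∀ {n : ℕ} {e : Fin n → H}, Orthonormal ℂ e →
      ∑ j, ENNReal.ofReal (⟪e j, ρ (e j)⟫_ℂ).re ≤ ∑' i, ‖ψ i‖ₑ ^ 2 := by
    intro n e he
    simp only [ofReal_re_inner_of_hasSum h]
    rw [← tsum_fintype (L := .unconditional _), ENNReal.tsum_comm]
    exact ENNReal.tsum_le_tsum fun i => tsum_enorm_inner_sq_le he _
  refine le_antisymm (traceNorm_le_iff.2 fun n e f he hf => ?_) ?_
  · have h2 : 2 * ∑ i, ‖⟪f i, ρ (e i)⟫_ℂ‖ₑ ≤ 2 * ∑' i, ‖ψ i‖ₑ ^ 2 := by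
      rw [Finset.mul_sum, two_mul]
      refine le_trans (Finset.sum_le_sum fun i _ =>
        enorm_inner_le_of_isPositive (isPositive_of_hasSum h) _ _) ?_
      rw [Finset.sum_add_distrib]
      exact add_le_add (hle hf) (hle he)
    exact (ENNReal.mul_le_mul_iff_right (by simp) (by simp)).1 h2
  · rw [← posTrace_of_hasSum h, posTrace, ENNReal.tsum_eq_iSup_sum]
    refine iSup_le fun s => ?_
    have ho : Orthonormal ℂ fun i : Fin s.card => onb H (s.equivFin.symm i : BasisIndex H) :=
      (onb H).orthonormal.comp _ (Subtype.val_injective.comp s.equivFin.symm.injective)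
    refine le_trans ?_ (traceNorm_le_iff.1 le_rfl _ _ _ ho ho)
    rw [← Finset.sum_coe_sort, ← s.equivFin.symm.sum_comp]
    refine Finset.sum_le_sum fun i _ => ?_
    rw [← ofReal_norm]
    exact ENNReal.ofReal_le_ofReal (Complex.re_le_norm _)

theorem enorm_le_traceNorm (T : H →L[ℂ] K) : ‖T‖ₑ ≤ traceNorm T := by
  have hunit : ∀ {x : H} {y : K}, ‖x‖ = 1 → ‖y‖ = 1 → ‖⟪y, T x⟫_ℂ‖ₑ ≤ traceNorm T := by
    intro x y hx hy
    have := traceNorm_le_iff.1 (le_refl (traceNorm T)) 1 (fun _ => x) (fun _ => y)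
      ⟨fun _ => hx, fun i j hij => (hij (Subsingleton.elim i j)).elim⟩
      ⟨fun _ => hy, fun i j hij => (hij (Subsingleton.elim i j)).elim⟩
    simpa using this
  by_cases htop : traceNorm T = ⊤
  · simp [htop]
  rw [← ofReal_norm, ENNReal.ofReal_le_iff_le_toReal htop]
  refine T.opNorm_le_of_unit_norm ENNReal.toReal_nonneg fun x hx => ?_
  by_cases h0 : T x = 0
  · simp [h0]
  have hn : ‖T x‖ ≠ 0 := norm_ne_zero_iff.2 h0
  have := hunit (y := (((‖T x‖⁻¹ : ℝ) : ℂ)) • T x) hx (by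
    rw [norm_smul]; simp [hn])
  rw [← ofReal_norm, ENNReal.ofReal_le_iff_le_toReal htop, inner_smul_left,
    inner_self_eq_norm_sq_to_K] at this
  refine le_trans (le_of_eq ?_) this
  simp
  field_simp

theorem hasSum_rankOne_map [CompleteSpace H] [CompleteSpace K] {ψ : ι → H} {ρ : H →L[ℂ] H}
    (h : HasSum (fun i => rankOne ℂ (ψ i) (ψ i)) ρ) (T : H →L[ℂ] K) :
    HasSum (fun i => rankOne ℂ (T (ψ i)) (T (ψ i)))
      (T.comp (ρ.comp (ContinuousLinearMap.adjoint T))) := by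
  have := (h.mapL ((ContinuousLinearMap.compL ℂ K H H).flip
    (ContinuousLinearMap.adjoint T))).mapL (ContinuousLinearMap.compL ℂ K H K T)
  convert this using 2 with i
  · simp [comp_rankOne, rankOne_comp]
  · rfl

/-- A positive operator `ρ` of finite trace is `∑ᵢ |√ρ eᵢ⟩⟨√ρ eᵢ|` for any orthonormal basis
`(eᵢ)`. -/
theorem exists_hasSum_rankOne_onb [CompleteSpace H] {ρ : H →L[ℂ] H} (hρ : ρ.IsPositive)
    (ht : posTrace ρ ≠ ⊤) :
    ∃ ψ : BasisIndex H → H, HasSum (fun i => rankOne ℂ (ψ i) (ψ i)) ρ := by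
  have h0 : 0 ≤ ρ := (ContinuousLinearMap.nonneg_iff_isPositive _).2 hρ
  let C : H →L[ℂ] H := CFC.sqrt ρ
  have hC0 : 0 ≤ C := CFC.sqrt_nonneg ρ
  have hCC : C * C = ρ := CFC.sqrt_mul_sqrt_self ρ h0
  have hCs : ∀ a b, ⟪C a, b⟫_ℂ = ⟪a, C b⟫_ℂ :=
    ((ContinuousLinearMap.nonneg_iff_isPositive C).1 hC0).isSymmetric
  have hCCx : ∀ a, C (C a) = ρ a := fun a => DFunLike.congr_fun hCC a
  have hn : ∀ i, ENNReal.ofReal (⟪onb H i, ρ (onb H i)⟫_ℂ).re = ‖C (onb H i)‖ₑ ^ 2 := by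
    intro i
    rw [← hCCx, ← hCs, enorm_sq_eq_ofReal]
    congr 1
    exact inner_self_eq_norm_sq (𝕜 := ℂ) _
  have hs : ∑' i, ‖C (onb H i)‖ₑ ^ 2 ≠ ⊤ := by
    simpa only [posTrace, hn] using ht
  obtain ⟨σ, hσ⟩ := summable_rankOne hs
  refine ⟨fun i => C (onb H i), ?_⟩
  convert hσ using 1
  ext x
  have h1 := hσ.mapL (ContinuousLinearMap.apply ℂ H x)
  have h2 := ((onb H).hasSum_repr (C x)).mapL C
  simp only [ContinuousLinearMap.apply_apply, rankOne_apply, hCs] at h1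
  simp only [(onb H).repr_apply_apply, map_smul, hCCx] at h2
  exact h2.unique h1

/-- Extension by zero turns a decomposition with a countable index set into a sequence. -/
theorem hasSum_rankOne_extend [Countable ι] {M : Submodule ℂ H} {ψ : ι → M} {ρ : H →L[ℂ] H}
    (h : HasSum (fun i => rankOne ℂ (ψ i : H) (ψ i : H)) ρ) :
    ∃ φ : ℕ → M, HasSum (fun i => rankOne ℂ (φ i : H) (φ i : H)) ρ := by
  obtain ⟨g, hg⟩ := exists_injective_nat ι
  refine ⟨Function.extend g ψ 0, ?_⟩
  rw [← hg.hasSum_iff]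
  · simpa [Function.comp_def, hg.extend_apply] using h
  · intro x hx
    rw [Function.extend_apply' _ _ _ (by simpa using hx)]
    simp

/-- Distinct elements of an orthonormal basis have distance `√2`. -/
instance [TopologicalSpace.SeparableSpace H] [CompleteSpace H] : Countable (BasisIndex H) := by
  have h := (onb H).orthonormal
  refine (TopologicalSpace.exists_countable_dense H).elim fun s hs => ?_
  choose f hf using fun i : BasisIndex H => Metric.dense_iff.1 hs.2 (onb H i) (1 / 2) (by norm_num)
  have hinj : Function.Injective fun i => (⟨f i, (hf i).2⟩ : s) := by
    intro i j hij
    by_contra hne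
    have hij' : f i = f j := congrArg Subtype.val hij
    have h1 : dist (onb H i) (onb H j) < 1 := by
      have a := Metric.mem_ball.1 (hf i).1
      have b := Metric.mem_ball.1 (hf j).1
      rw [hij'] at a
      rw [dist_comm] at a
      linarith [dist_triangle (onb H i) (f j) (onb H j)]
    have h2 : ‖onb H i - onb H j‖ ^ 2 = 2 := by
      have := @norm_sub_sq ℂ H _ _ _ (onb H i) (onb H j)
      rw [h.2 hne, h.1, h.1] at this
      rw [this]; norm_num
    rw [dist_eq_norm] at h1
    nlinarith [norm_nonneg (onb H i - onb H j)]
  have := hs.1.to_subtype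
  exact hinj.countable

end Outer

end ECD

/-! ### Energy, the resolvent of the square root, and `V ρ V*` -/

namespace ECD

section Energy

variable {H : Type*} [NormedAddCommGroup H] [InnerProductSpace ℂ H] [CompleteSpace H]
variable {K : Type*} [NormedAddCommGroup K] [InnerProductSpace ℂ K] [CompleteSpace K]
variable {ι : Type*} {G : H →ₗ.[ℂ] H}

theorem inner_sqrtOp (hG : IsPosSelfAdjoint G) (x y : (sqrtOp G).domain) :
    ⟪sqrtOp G x, (y : H)⟫_ℂ = ⟪(x : H), sqrtOp G y⟫_ℂ := by
  have hS := (sqrtOp_spec hG).pos.selfAdjoint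
  have hfa := LinearPMap.adjoint_isFormalAdjoint hS.dense_domain
  have hA : (sqrtOp G).adjoint = sqrtOp G := hS
  rw [hA] at hfa
  exact hfa x y

theorem ofReal_inner_le_energy {ρ : H →L[ℂ] H} {x : (sqrtOp G).domain} (hx : ‖(x : H)‖ = 1) :
    ENNReal.ofReal (⟪sqrtOp G x, ρ (sqrtOp G x)⟫_ℂ).re ≤ energy G ρ := by
  have h : Orthonormal ℂ (fun _ : Fin 1 => (x : H)) :=
    ⟨fun _ => hx, fun i j hij => (hij (Subsingleton.elim i j)).elim⟩
  refine le_trans ?_ (le_iSup_of_le 1 (le_iSup_of_le (fun _ => x) (le_iSup_of_le h le_rfl)))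
  simp

/-- The vectors of any decomposition of an operator of finite energy lie in `D(√G)`: they induce
functionals `x ↦ ⟨φᵢ, √G x⟩` bounded by the energy, and `√G` is its own adjoint. -/
theorem mem_domain_of_energy_ne_top (hG : IsPosSelfAdjoint G) {φ : ι → H} {ρ : H →L[ℂ] H}
    (h : HasSum (fun i => rankOne ℂ (φ i) (φ i)) ρ) (hE : energy G ρ ≠ ⊤) (i : ι) :
    φ i ∈ (sqrtOp G).domain := by
  have hA : (sqrtOp G).adjoint = sqrtOp G := (sqrtOp_spec hG).pos.selfAdjoint
  have hunit : ∀ x : (sqrtOp G).domain, ‖(x : H)‖ = 1 →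
      ‖⟪φ i, sqrtOp G x⟫_ℂ‖ ^ 2 ≤ (energy G ρ).toReal := by
    intro x hx
    rw [← ENNReal.ofReal_le_iff_le_toReal hE, ← enorm_sq_eq_ofReal]
    refine le_trans ?_ (ofReal_inner_le_energy hx)
    rw [ofReal_re_inner_of_hasSum h, ← enorm_norm, norm_inner_symm, enorm_norm]
    exact ENNReal.le_tsum (f := fun i => ‖⟪sqrtOp G x, φ i⟫_ℂ‖ₑ ^ 2) i
  have hb : ∀ x : (sqrtOp G).domain,
      ‖⟪φ i, sqrtOp G x⟫_ℂ‖ ≤ √(energy G ρ).toReal * ‖x‖ := by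
    intro x
    by_cases h0 : x = 0
    · simp [h0]
    have hn : ‖(x : H)‖ ≠ 0 := by simpa using h0
    have h1 := hunit ((((‖(x : H)‖⁻¹ : ℝ) : ℂ)) • x) (by
      rw [Submodule.coe_smul, norm_smul]; simp [hn])
    rw [LinearPMap.map_smul, inner_smul_right, norm_mul] at h1
    have h2 := Real.le_sqrt_of_sq_le h1
    rw [Complex.norm_real, norm_inv, norm_norm, inv_mul_le_iff₀ (by positivity)] at h2
    rw [mul_comm]
    exact h2
  rw [← hA, LinearPMap.mem_adjoint_domain_iff]
  exact AddMonoidHomClass.continuous_of_bound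
    ((innerₛₗ ℂ (φ i)).comp (sqrtOp G).toFun) (√(energy G ρ).toReal) hb

/-- Vectors approximated by a finite-dimensional subspace are nearly captured by one of its
orthonormal bases. -/
theorem enorm_sq_le_sum_inner_add {H : Type*} [NormedAddCommGroup H] [InnerProductSpace ℂ H]
    (F : Submodule ℂ H) [FiniteDimensional ℂ F] {n : ℕ}
    (b : OrthonormalBasis (Fin n) ℂ F) (x : H) {d : H} (hd : d ∈ F) :
    ‖x‖ₑ ^ 2 ≤ ∑ j, ‖⟪(b j : H), x⟫_ℂ‖ₑ ^ 2 + ‖x - d‖ₑ ^ 2 := by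
  have h1 : ‖F.orthogonalProjectionOnto x‖ ^ 2 = ∑ j, ‖⟪(b j : H), x⟫_ℂ‖ ^ 2 := by
    rw [← b.sum_sq_norm_inner_right]
    refine Finset.sum_congr rfl fun j _ => ?_
    rw [Submodule.inner_orthogonalProjectionOnto_eq_of_mem_left]
  have h2 := F.norm_sq_eq_add_norm_sq_projection x
  have h3 : ‖Fᗮ.orthogonalProjectionOnto x‖ ≤ ‖x - d‖ := by
    have : Fᗮ.orthogonalProjectionOnto d = 0 :=
      Submodule.orthogonalProjectionOnto_orthogonal_apply_eq_zero hd
    calc ‖Fᗮ.orthogonalProjectionOnto x‖ = ‖Fᗮ.orthogonalProjectionOnto (x - d)‖ := by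
          rw [map_sub, this, sub_zero]
      _ ≤ ‖x - d‖ := Submodule.norm_orthogonalProjectionOnto_apply_le _ _
  simp only [enorm_sq_eq_ofReal]
  rw [← ENNReal.ofReal_sum_of_nonneg (fun _ _ => sq_nonneg _),
    ← ENNReal.ofReal_add (Finset.sum_nonneg fun _ _ => sq_nonneg _) (sq_nonneg _), ← h1]
  refine ENNReal.ofReal_le_ofReal ?_
  rw [h2]
  gcongr

/-- The energy of `∑ᵢ |φᵢ⟩⟨φᵢ|`. Bessel's inequality gives `≤`. For `≥`, finitely many of the vectors
`√G φᵢ` are approximated from the dense subspace `D(√G)`, and an orthonormal basis of the span of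
the approximants is a test family in `D(√G)`. -/
theorem energy_of_hasSum (hG : IsPosSelfAdjoint G) {φ : ι → (sqrtOp G).domain} {ρ : H →L[ℂ] H}
    (h : HasSum (fun i => rankOne ℂ (φ i : H) (φ i : H)) ρ) :
    energy G ρ = ∑' i, ‖sqrtOp G (φ i)‖ₑ ^ 2 := by
  have key : ∀ x : (sqrtOp G).domain,
      ENNReal.ofReal (⟪sqrtOp G x, ρ (sqrtOp G x)⟫_ℂ).re =
        ∑' i, ‖⟪(x : H), sqrtOp G (φ i)⟫_ℂ‖ₑ ^ 2 := by
    intro x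
    simp only [ofReal_re_inner_of_hasSum h, inner_sqrtOp hG]
  have swap : ∀ {n : ℕ} (f : Fin n → (sqrtOp G).domain),
      ∑ j, ENNReal.ofReal (⟪sqrtOp G (f j), ρ (sqrtOp G (f j))⟫_ℂ).re =
        ∑' i, ∑ j, ‖⟪(f j : H), sqrtOp G (φ i)⟫_ℂ‖ₑ ^ 2 := by
    intro n f
    simp only [key, ← tsum_fintype (L := .unconditional _)]
    rw [ENNReal.tsum_comm]
  apply le_antisymm
  · refine iSup_le fun n => iSup_le fun f => iSup_le fun hf => ?_
    rw [swap]
    refine ENNReal.tsum_le_tsum fun i => ?_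
    rw [← tsum_fintype (L := .unconditional _)]
    exact tsum_enorm_inner_sq_le hf _
  · rw [ENNReal.tsum_eq_iSup_sum]
    refine iSup_le fun s => ENNReal.le_of_forall_pos_le_add fun ε hε _ => ?_
    set δ : ℝ := √(ε / (s.card + 1)) with hδ
    have hε' : (0 : ℝ) < ε := hε
    have hδ0 : 0 < δ := Real.sqrt_pos.2 (by positivity)
    have hdense := (sqrtOp_spec hG).pos.selfAdjoint.dense_domain
    choose d hd using fun i => Metric.dense_iff.1 hdense (sqrtOp G (φ i)) δ hδ0
    let F : Submodule ℂ H := Submodule.span ℂ (d '' s)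
    have hF : F ≤ (sqrtOp G).domain := by
      refine Submodule.span_le.2 ?_
      rintro _ ⟨i, -, rfl⟩
      exact (hd i).2
    have : FiniteDimensional ℂ F := FiniteDimensional.span_of_finite ℂ (s.finite_toSet.image d)
    let b := stdOrthonormalBasis ℂ F
    let f : Fin (Module.finrank ℂ F) → (sqrtOp G).domain := fun j => ⟨b j, hF (b j).2⟩
    have hf : Orthonormal ℂ (fun j => (f j : H)) := b.orthonormal.comp_linearIsometry F.subtypeₗᵢ
    calc ∑ i ∈ s, ‖sqrtOp G (φ i)‖ₑ ^ 2
        ≤ ∑ i ∈ s, (∑ j, ‖⟪(f j : H), sqrtOp G (φ i)⟫_ℂ‖ₑ ^ 2 +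
            ENNReal.ofReal (ε / (s.card + 1))) := by
          refine Finset.sum_le_sum fun i hi => ?_
          refine (enorm_sq_le_sum_inner_add F b (sqrtOp G (φ i)) (d := d i)
            (Submodule.subset_span ⟨i, hi, rfl⟩)).trans ?_
          gcongr
          rw [enorm_sq_eq_ofReal]
          refine ENNReal.ofReal_le_ofReal ?_
          have h1 : ‖sqrtOp G (φ i) - d i‖ ≤ δ := by
            rw [← dist_eq_norm, dist_comm]
            exact (Metric.mem_ball.1 (hd i).1).le
          calc ‖sqrtOp G (φ i) - d i‖ ^ 2 ≤ δ ^ 2 := by gcongr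
            _ = (ε : ℝ) / (s.card + 1) := Real.sq_sqrt (by positivity)
      _ ≤ ∑' i, ∑ j, ‖⟪(f j : H), sqrtOp G (φ i)⟫_ℂ‖ₑ ^ 2 + ε := by
          rw [Finset.sum_add_distrib]
          refine add_le_add (ENNReal.sum_le_tsum s) ?_
          rw [Finset.sum_const, nsmul_eq_mul, ← ENNReal.ofReal_natCast,
            ← ENNReal.ofReal_mul (by positivity), ← ENNReal.ofReal_coe_nnreal]
          refine ENNReal.ofReal_le_ofReal ?_
          rw [← mul_div_assoc, div_le_iff₀ (by positivity)]
          nlinarith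
      _ ≤ energy G ρ + ε := by
          rw [← swap]
          gcongr
          exact le_iSup_of_le _ (le_iSup_of_le f (le_iSup_of_le hf le_rfl))

/-- The bijection `x ↦ x + √G x` from `D(√G)` onto `H`. Its inverse is the resolvent
`(1 + √G)⁻¹`, which turns relatively bounded operators into bounded ones. -/
noncomputable def resolventEquiv (hG : IsPosSelfAdjoint G) : (sqrtOp G).domain ≃ₗ[ℂ] H :=
  LinearEquiv.ofBijective ((sqrtOp G).domain.subtype + (sqrtOp G).toFun) <| by
    have hS := (sqrtOp_spec hG).pos
    constructor
    · rw [← LinearMap.ker_eq_bot, LinearMap.ker_eq_bot']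
      intro x hx
      have h1 := norm_le_norm_add hS ((sqrtOp G).mem_graph x)
      have h2 : (x : H) + sqrtOp G x = 0 := hx
      rw [h2, norm_zero, norm_le_zero_iff] at h1
      exact Subtype.ext h1
    · intro h
      obtain ⟨x, y, hxy, rfl⟩ := exists_resolvent hS h
      obtain ⟨u, rfl, rfl⟩ := (LinearPMap.mem_graph_iff _).1 hxy
      exact ⟨u, rfl⟩

theorem resolventEquiv_apply (hG : IsPosSelfAdjoint G) (x : (sqrtOp G).domain) :
    resolventEquiv hG x = x + sqrtOp G x := rfl

theorem norm_resolventEquiv_symm_le (hG : IsPosSelfAdjoint G) (h : H) :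
    ‖((resolventEquiv hG).symm h : H)‖ ≤ ‖h‖ := by
  have h1 := norm_le_norm_add (sqrtOp_spec hG).pos
    ((sqrtOp G).mem_graph ((resolventEquiv hG).symm h))
  rwa [← resolventEquiv_apply hG, LinearEquiv.apply_symm_apply] at h1

theorem norm_sqrtOp_resolventEquiv_symm_le (hG : IsPosSelfAdjoint G) (h : H) :
    ‖sqrtOp G ((resolventEquiv hG).symm h)‖ ≤ 2 * ‖h‖ := by
  have h1 : sqrtOp G ((resolventEquiv hG).symm h) = h - ((resolventEquiv hG).symm h : H) := by
    rw [eq_sub_iff_add_eq', ← resolventEquiv_apply hG, LinearEquiv.apply_symm_apply]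
  rw [h1]
  linarith [norm_sub_le h ((resolventEquiv hG).symm h : H), norm_resolventEquiv_symm_le hG h]

/-- The resolvent `(1 + √G)⁻¹` as a bounded operator on `H`. -/
noncomputable def resolvent (hG : IsPosSelfAdjoint G) : H →L[ℂ] H :=
  LinearMap.mkContinuous
    ((sqrtOp G).domain.subtype ∘ₗ ((resolventEquiv hG).symm : H →ₗ[ℂ] (sqrtOp G).domain)) 1
    fun h => by simpa using norm_resolventEquiv_symm_le hG h

theorem resolvent_apply (hG : IsPosSelfAdjoint G) (h : H) :
    resolvent hG h = (resolventEquiv hG).symm h := rfl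

theorem resolvent_resolventEquiv (hG : IsPosSelfAdjoint G) (x : (sqrtOp G).domain) :
    resolvent hG (resolventEquiv hG x) = x := by
  rw [resolvent_apply, LinearEquiv.symm_apply_apply]

theorem resolvent_injective (hG : IsPosSelfAdjoint G) : Function.Injective (resolvent hG) :=
  Subtype.val_injective.comp (resolventEquiv hG).symm.injective

/-- The bounded operator `V (1 + √G)⁻¹`, for a relatively bounded `V`. -/
theorem IsRelBounded.exists_comp_resolvent {K : Type*} [NormedAddCommGroup K]
    [InnerProductSpace ℂ K] (hG : IsPosSelfAdjoint G)
    {V : (sqrtOp G).domain →ₗ[ℂ] K} (hV : IsRelBounded G V) :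
    ∃ W : H →L[ℂ] K, ∀ x, W (resolventEquiv hG x) = V x := by
  obtain ⟨a, b, ha, hb, hab⟩ := hV
  refine ⟨LinearMap.mkContinuous (V ∘ₗ ((resolventEquiv hG).symm : H →ₗ[ℂ] (sqrtOp G).domain))
    (a + 2 * b) fun h => ?_, fun x => ?_⟩
  · have h1 := hab ((resolventEquiv hG).symm h)
    refine abs_le_of_sq_le_sq' ?_ (by positivity) |>.2
    refine h1.trans ?_
    have h2 := norm_resolventEquiv_symm_le hG h
    have h3 := norm_sqrtOp_resolventEquiv_symm_le hG h
    calc a ^ 2 * ‖((resolventEquiv hG).symm h : H)‖ ^ 2 +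
          b ^ 2 * ‖sqrtOp G ((resolventEquiv hG).symm h)‖ ^ 2
        ≤ a ^ 2 * ‖h‖ ^ 2 + b ^ 2 * (2 * ‖h‖) ^ 2 := by gcongr
      _ ≤ ((a + 2 * b) * ‖h‖) ^ 2 := by
          have : 0 ≤ a * b * ‖h‖ ^ 2 := by positivity
          nlinarith
  · change V ((resolventEquiv hG).symm (resolventEquiv hG x)) = V x
    rw [LinearEquiv.symm_apply_apply]

theorem IsRelBounded.tsum_ne_top {K : Type*} [NormedAddCommGroup K] [InnerProductSpace ℂ K]
    {V : (sqrtOp G).domain →ₗ[ℂ] K} (hV : IsRelBounded G V) {φ : ι → (sqrtOp G).domain}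
    (ht : ∑' i, ‖(φ i : H)‖ₑ ^ 2 ≠ ⊤) (hE : ∑' i, ‖sqrtOp G (φ i)‖ₑ ^ 2 ≠ ⊤) :
    ∑' i, ‖V (φ i)‖ₑ ^ 2 ≠ ⊤ := by
  obtain ⟨a, b, -, -, hab⟩ := hV
  rw [tsum_enorm_sq_ne_top_iff] at hE ht ⊢
  exact Summable.of_nonneg_of_le (fun _ => sq_nonneg _) (fun i => hab (φ i))
    ((ht.mul_left _).add (hE.mul_left _))

/-- For injective `T` the operator `σ` is determined by `T σ T*`, since `T*` has dense range. -/
theorem eq_of_comp_comp_adjoint_eq {T : H →L[ℂ] K} (hT : Function.Injective T) {σ τ : H →L[ℂ] H}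
    (h : T.comp (σ.comp (ContinuousLinearMap.adjoint T)) =
      T.comp (τ.comp (ContinuousLinearMap.adjoint T))) : σ = τ := by
  have h1 : ∀ y, σ (ContinuousLinearMap.adjoint T y) = τ (ContinuousLinearMap.adjoint T y) :=
    fun y => hT (DFunLike.congr_fun h y)
  have hd : DenseRange (ContinuousLinearMap.adjoint T) := by
    have : Dense ((LinearMap.range (ContinuousLinearMap.adjoint T : K →ₗ[ℂ] H) : Submodule ℂ H) :
        Set H) := by
      rw [Submodule.dense_iff_topologicalClosure_eq_top, Submodule.topologicalClosure_eq_top_iff,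
        Submodule.eq_bot_iff]
      intro w hw
      rw [Submodule.mem_orthogonal] at hw
      apply hT
      rw [map_zero, ← inner_self_eq_zero (𝕜 := ℂ), ← ContinuousLinearMap.adjoint_inner_left]
      exact hw _ ⟨T w, rfl⟩
    exact this
  exact DFunLike.coe_injective (hd.equalizer σ.continuous τ.continuous (funext h1))

theorem tsum_enorm_resolventEquiv_sq_ne_top (hG : IsPosSelfAdjoint G)
    {φ : ι → (sqrtOp G).domain} (ht : ∑' i, ‖(φ i : H)‖ₑ ^ 2 ≠ ⊤)
    (hE : ∑' i, ‖sqrtOp G (φ i)‖ₑ ^ 2 ≠ ⊤) : ∑' i, ‖resolventEquiv hG (φ i)‖ₑ ^ 2 ≠ ⊤ := by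
  rw [tsum_enorm_sq_ne_top_iff] at ht hE ⊢
  refine Summable.of_nonneg_of_le (fun _ => sq_nonneg _) (fun i => ?_)
    ((ht.add hE).mul_left 2)
  rw [resolventEquiv_apply]
  exact (pow_le_pow_left₀ (norm_nonneg _) (norm_add_le _ _) 2).trans add_sq_le

/-- Every decomposition `ρ = ∑ᵢ |φᵢ⟩⟨φᵢ|` of finite energy comes from the decomposition
`σ = ∑ᵢ |(1 + √G)φᵢ⟩⟨(1 + √G)φᵢ|` of an operator `σ` with `ρ = (1 + √G)⁻¹ σ (1 + √G)⁻¹`. -/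
theorem exists_hasSum_resolventEquiv (hG : IsPosSelfAdjoint G) {φ : ι → (sqrtOp G).domain}
    {ρ : H →L[ℂ] H} (h : HasSum (fun i => rankOne ℂ (φ i : H) (φ i : H)) ρ)
    (ht : posTrace ρ ≠ ⊤) (hE : energy G ρ ≠ ⊤) :
    ∃ σ : H →L[ℂ] H,
      HasSum (fun i => rankOne ℂ (resolventEquiv hG (φ i)) (resolventEquiv hG (φ i))) σ ∧
      (resolvent hG).comp (σ.comp (ContinuousLinearMap.adjoint (resolvent hG))) = ρ := by
  rw [posTrace_of_hasSum h] at ht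
  rw [energy_of_hasSum hG h] at hE
  obtain ⟨σ, hσ⟩ := summable_rankOne (tsum_enorm_resolventEquiv_sq_ne_top hG ht hE)
  refine ⟨σ, hσ, ?_⟩
  have h2 := hasSum_rankOne_map hσ (resolvent hG)
  simp only [resolvent_resolventEquiv] at h2
  exact h2.unique h

theorem exists_decomposition_of_energy_ne_top [TopologicalSpace.SeparableSpace H]
    (hG : IsPosSelfAdjoint G) {ρ : H →L[ℂ] H} (hρ : ρ.IsPositive) (ht : posTrace ρ ≠ ⊤)
    (hE : energy G ρ ≠ ⊤) : ∃ φ, IsDecomposition G ρ φ := by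
  obtain ⟨ψ, hψ⟩ := exists_hasSum_rankOne_onb hρ ht
  exact hasSum_rankOne_extend (M := (sqrtOp G).domain)
    (ψ := fun i => ⟨ψ i, mem_domain_of_energy_ne_top hG hψ hE i⟩) hψ

/-- `V ρ V* = ∑ᵢ |V φᵢ⟩⟨V φᵢ|` for every decomposition of `ρ`: both sides are `W σ W*` with
`W = V (1 + √G)⁻¹`, and `σ` is determined by `ρ`. -/
theorem hasSum_sandwich [TopologicalSpace.SeparableSpace H] (hG : IsPosSelfAdjoint G)
    {V : (sqrtOp G).domain →ₗ[ℂ] K} (hV : IsRelBounded G V) {φ : ι → (sqrtOp G).domain}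
    {ρ : H →L[ℂ] H} (h : HasSum (fun i => rankOne ℂ (φ i : H) (φ i : H)) ρ)
    (ht : posTrace ρ ≠ ⊤) (hE : energy G ρ ≠ ⊤) :
    HasSum (fun i => rankOne ℂ (V (φ i)) (V (φ i))) (sandwich G V ρ) := by
  obtain ⟨W, hW⟩ := hV.exists_comp_resolvent hG
  obtain ⟨σ, hσ, hσρ⟩ := exists_hasSum_resolventEquiv hG h ht hE
  have key : ∀ {κ : Type _} {χ : κ → (sqrtOp G).domain},
      HasSum (fun i => rankOne ℂ (χ i : H) (χ i : H)) ρ →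
      HasSum (fun i => rankOne ℂ (V (χ i)) (V (χ i)))
        (W.comp (σ.comp (ContinuousLinearMap.adjoint W))) := by
    intro κ χ hχ
    obtain ⟨τ, hτ, hτρ⟩ := exists_hasSum_resolventEquiv hG hχ ht hE
    have : τ = σ := eq_of_comp_comp_adjoint_eq (resolvent_injective hG) (hτρ.trans hσρ.symm)
    rw [this] at hτ
    simpa only [hW] using hasSum_rankOne_map hτ W
  have hsand : IsSandwich G V ρ (W.comp (σ.comp (ContinuousLinearMap.adjoint W))) :=
    ⟨exists_decomposition_of_energy_ne_top hG (isPositive_of_hasSum h) ht hE,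
      fun χ hχ => key hχ⟩
  have hspec : IsSandwich G V ρ (sandwich G V ρ) := Classical.epsilon_spec ⟨_, hsand⟩
  obtain ⟨χ, hχ⟩ := hsand.1
  have h1 := hasSum_rankOne_map hσ W
  simp only [hW] at h1
  rwa [← (hsand.2 χ hχ).unique (hspec.2 χ hχ)]

end Energy

end ECD

/-! ### Kraus families and the growth of the Kraus norm -/

namespace ECD

section Kraus

variable {H : Type*} [NormedAddCommGroup H] [InnerProductSpace ℂ H] [CompleteSpace H]
variable {K : Type*} [NormedAddCommGroup K] [InnerProductSpace ℂ K] [CompleteSpace K]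
variable {ι : Type*} {κ : Type} {G : H →ₗ.[ℂ] H}

theorem enorm_sqrt_smul_sq {E : Type*} [NormedAddCommGroup E] [NormedSpace ℂ E] {t : ℝ}
    (ht : 0 ≤ t) (x : E) : ‖((√t : ℝ) : ℂ) • x‖ₑ ^ 2 = ENNReal.ofReal t * ‖x‖ₑ ^ 2 := by
  rw [enorm_smul, mul_pow, enorm_sq_eq_ofReal (√t : ℂ), Complex.norm_real, Real.norm_eq_abs,
    sq_abs, Real.sq_sqrt ht]

theorem hasSum_rankOne_sqrt_smul {E : Type*} [NormedAddCommGroup E] [InnerProductSpace ℂ E]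
    {ψ : ι → E} {ρ : E →L[ℂ] E} (h : HasSum (fun i => rankOne ℂ (ψ i) (ψ i)) ρ) {t : ℝ}
    (ht : 0 ≤ t) :
    HasSum (fun i => rankOne ℂ (((√t : ℝ) : ℂ) • ψ i) (((√t : ℝ) : ℂ) • ψ i)) ((t : ℂ) • ρ) := by
  convert h.const_smul (t : ℂ) using 2 with i
  ext x
  simp only [rankOne_apply, inner_smul_left, Complex.conj_ofReal, smul_smul, smul_apply]
  rw [mul_right_comm, ← Complex.ofReal_mul, Real.mul_self_sqrt ht]

theorem isState_of_hasSum {ψ : ι → H} {ρ : H →L[ℂ] H}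
    (h : HasSum (fun i => rankOne ℂ (ψ i) (ψ i)) ρ) (h1 : ∑' i, ‖ψ i‖ₑ ^ 2 = 1) : IsState ρ :=
  ⟨isPositive_of_hasSum h, by rw [posTrace_of_hasSum h, h1]⟩

theorem IsState.posTrace_ne_top {ρ : H →L[ℂ] H} (h : IsState ρ) : posTrace ρ ≠ ⊤ := by
  simp [h.2]

theorem krausNorm_mono {V : κ → (sqrtOp G).domain →ₗ[ℂ] K} : Monotone (krausNorm G V) := by
  intro E E' hEE'
  refine iSup_mono fun ρ => iSup_mono fun hs => iSup_le fun hE => ?_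
  exact le_iSup_of_le (hE.trans (ENNReal.ofReal_le_ofReal hEE')) le_rfl

/-- There are pure states of arbitrarily small energy, as `‖√G x‖² = ⟨x, G x⟩ ≤ ‖G x‖` for unit
vectors `x ∈ D(G)`. -/
theorem exists_unit_energy_le (hG : IsPosSelfAdjoint G) (hG0 : HasZeroInf G) {ε : ℝ}
    (hε : 0 < ε) : ∃ u : (sqrtOp G).domain, ‖(u : H)‖ = 1 ∧ ‖sqrtOp G u‖ ^ 2 ≤ ε := by
  obtain ⟨_, ⟨x, hx1, rfl⟩, -, hx2⟩ := hG0.exists_between hε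
  obtain ⟨z, hz1, hz2⟩ := ((sqrtOp_spec hG).sq x (G x)).1 (G.mem_graph x)
  obtain ⟨u, hu1, hu2⟩ := (LinearPMap.mem_graph_iff _).1 hz1
  obtain ⟨w, hw1, hw2⟩ := (LinearPMap.mem_graph_iff _).1 hz2
  simp only at hu1 hu2 hw1 hw2
  refine ⟨u, by rw [hu1, hx1], ?_⟩
  have h1 : ⟪sqrtOp G u, (w : H)⟫_ℂ = ⟪(u : H), sqrtOp G w⟫_ℂ := inner_sqrtOp hG u w
  rw [hw1, hu2, hw2, hu1] at h1
  have h2 : ‖z‖ ^ 2 = (⟪z, z⟫_ℂ).re := (inner_self_eq_norm_sq (𝕜 := ℂ) z).symm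
  rw [hu2, h2, h1]
  refine (Complex.re_le_norm _).trans ((norm_inner_le_norm _ _).trans ?_)
  rw [hx1, one_mul]
  exact hx2.le

variable [TopologicalSpace.SeparableSpace H]

theorem tsum_enorm_sq_le_krausNorm (hG : IsPosSelfAdjoint G) {V : κ → (sqrtOp G).domain →ₗ[ℂ] K}
    (hV : ∀ k, IsRelBounded G (V k)) {E : ℝ} {φ : ι → (sqrtOp G).domain}
    (h1 : ∑' i, ‖(φ i : H)‖ₑ ^ 2 = 1) (h2 : ∑' i, ‖sqrtOp G (φ i)‖ₑ ^ 2 ≤ ENNReal.ofReal E) :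
    ∑' k, ∑' i, ‖V k (φ i)‖ₑ ^ 2 ≤ krausNorm G V E := by
  obtain ⟨ρ, hρ⟩ := summable_rankOne (ψ := fun i => (φ i : H)) (by rw [h1]; simp)
  have hs := isState_of_hasSum hρ h1
  have hE : energy G ρ ≤ ENNReal.ofReal E := by rwa [energy_of_hasSum hG hρ]
  refine le_trans (le_of_eq ?_) (le_iSup_of_le ρ (le_iSup_of_le hs (le_iSup_of_le hE le_rfl)))
  refine tsum_congr fun k => ?_
  rw [posTrace_of_hasSum (hasSum_sandwich hG (hV k) hρ hs.posTrace_ne_top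
    (hE.trans_lt ENNReal.ofReal_lt_top).ne)]

theorem krausNorm_le (hG : IsPosSelfAdjoint G) {V : κ → (sqrtOp G).domain →ₗ[ℂ] K}
    (hV : ∀ k, IsRelBounded G (V k)) {E : ℝ} {C : ℝ≥0∞}
    (h : ∀ φ : ℕ → (sqrtOp G).domain, ∑' i, ‖(φ i : H)‖ₑ ^ 2 = 1 →
      ∑' i, ‖sqrtOp G (φ i)‖ₑ ^ 2 ≤ ENNReal.ofReal E → ∑' k, ∑' i, ‖V k (φ i)‖ₑ ^ 2 ≤ C) :
    krausNorm G V E ≤ C := by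
  refine iSup_le fun ρ => iSup_le fun hs => iSup_le fun hE => ?_
  have hE' : energy G ρ ≠ ⊤ := (hE.trans_lt ENNReal.ofReal_lt_top).ne
  obtain ⟨φ, hφ⟩ := exists_decomposition_of_energy_ne_top hG hs.1 hs.posTrace_ne_top hE'
  refine le_trans (le_of_eq ?_) (h φ ?_ ?_)
  · exact tsum_congr fun k =>
      posTrace_of_hasSum (hasSum_sandwich hG (hV k) hφ hs.posTrace_ne_top hE')
  · rw [← posTrace_of_hasSum hφ, hs.2]
  · rwa [← energy_of_hasSum hG hφ]

/-- The Kraus norm grows at most linearly in the energy: mixing a state of energy `E'` with a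
pure state of small energy, in the proportion `E / (2 E')`, gives a state of energy at most `E`. -/
theorem ofReal_mul_krausNorm_le (hG : IsPosSelfAdjoint G) (hG0 : HasZeroInf G)
    {V : κ → (sqrtOp G).domain →ₗ[ℂ] K} (hV : ∀ k, IsRelBounded G (V k)) {E E' : ℝ}
    (hE : 0 < E) (hEE' : E ≤ E') :
    krausNorm G V E' ≤ ENNReal.ofReal (2 * E' / E) * krausNorm G V E := by
  have hE' : 0 < E' := hE.trans_le hEE'
  obtain ⟨u, hu1, hu2⟩ := exists_unit_energy_le hG hG0 (half_pos hE)
  set p : ℝ := E / (2 * E') with hp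
  have hp0 : 0 < p := by positivity
  have hp1 : p ≤ 1 := by rw [hp, div_le_one (by positivity)]; linarith
  have hq0 : 0 ≤ 1 - p := by linarith
  have hpE : p * E' = E / 2 := by rw [hp]; field_simp
  have hinv : 2 * E' / E = p⁻¹ := by rw [hp, inv_div]
  refine krausNorm_le hG hV fun φ h1 h2 => ?_
  -- the vectors of the mixture `p ρ + (1 - p) |u⟩⟨u|`
  let χ : ℕ ⊕ Unit → (sqrtOp G).domain :=
    Sum.elim (fun i => ((√p : ℝ) : ℂ) • φ i) fun _ => ((√(1 - p) : ℝ) : ℂ) • u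
  have hsum : ∀ f : ℕ ⊕ Unit → ℝ≥0∞, ∑' i, f i = ∑' i, f (.inl i) + f (.inr ()) := fun f => by
    rw [Summable.tsum_sum ENNReal.summable ENNReal.summable]; simp
  have hχ1 : ∑' i, ‖(χ i : H)‖ₑ ^ 2 = 1 := by
    rw [hsum]
    simp only [χ, Sum.elim_inl, Sum.elim_inr, Submodule.coe_smul]
    simp only [enorm_sqrt_smul_sq hp0.le, enorm_sqrt_smul_sq hq0]
    rw [ENNReal.tsum_mul_left, h1, enorm_sq_eq_ofReal (u : H), hu1]
    simp only [one_pow, ENNReal.ofReal_one, mul_one]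
    rw [← ENNReal.ofReal_add hp0.le hq0]
    simp
  have hχ2 : ∑' i, ‖sqrtOp G (χ i)‖ₑ ^ 2 ≤ ENNReal.ofReal E := by
    rw [hsum]
    simp only [χ, Sum.elim_inl, Sum.elim_inr, LinearPMap.map_smul]
    simp only [enorm_sqrt_smul_sq hp0.le, enorm_sqrt_smul_sq hq0]
    rw [ENNReal.tsum_mul_left, enorm_sq_eq_ofReal (sqrtOp G u)]
    calc ENNReal.ofReal p * ∑' i, ‖sqrtOp G (φ i)‖ₑ ^ 2 +
          ENNReal.ofReal (1 - p) * ENNReal.ofReal (‖sqrtOp G u‖ ^ 2)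
        ≤ ENNReal.ofReal p * ENNReal.ofReal E' + ENNReal.ofReal 1 * ENNReal.ofReal (E / 2) := by
          gcongr
          linarith
      _ = ENNReal.ofReal E := by
          rw [← ENNReal.ofReal_mul hp0.le, hpE, ← ENNReal.ofReal_mul zero_le_one,
            ← ENNReal.ofReal_add (by positivity) (by positivity)]
          congr 1
          ring
  have h3 := tsum_enorm_sq_le_krausNorm hG hV hχ1 hχ2
  have h4 : ENNReal.ofReal p * ∑' k, ∑' i, ‖V k (φ i)‖ₑ ^ 2 ≤ krausNorm G V E := by
    refine le_trans ?_ h3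
    rw [← ENNReal.tsum_mul_left]
    refine ENNReal.tsum_le_tsum fun k => ?_
    rw [hsum, ← ENNReal.tsum_mul_left]
    simp only [χ, Sum.elim_inl, map_smul, enorm_sqrt_smul_sq hp0.le]
    exact le_self_add
  rw [hinv, ENNReal.ofReal_inv_of_pos hp0, ← ENNReal.mul_le_iff_le_inv
    (by simpa using hp0) ENNReal.ofReal_ne_top]
  exact h4

theorem krausNorm_lt_top (hG : IsPosSelfAdjoint G) (hG0 : HasZeroInf G)
    {V : κ → (sqrtOp G).domain →ₗ[ℂ] K} (hV : ∀ k, IsRelBounded G (V k)) {E : ℝ} (hE : 0 < E)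
    (hfin : krausNorm G V E < ⊤) (E' : ℝ) : krausNorm G V E' < ⊤ := by
  rcases le_total E' E with h | h
  · exact (krausNorm_mono h).trans_lt hfin
  · exact (ofReal_mul_krausNorm_le hG hG0 hV hE h).trans_lt
      (ENNReal.mul_lt_top ENNReal.ofReal_lt_top hfin)

/-- A finite Kraus norm at one energy bounds `∑ₖ ‖Vₖ φ‖²` relatively to `√G`. -/
theorem tsum_enorm_sq_le_add (hG : IsPosSelfAdjoint G) (hG0 : HasZeroInf G)
    {V : κ → (sqrtOp G).domain →ₗ[ℂ] K} (hV : ∀ k, IsRelBounded G (V k)) {E : ℝ} (hE : 0 < E)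
    (φ : (sqrtOp G).domain) :
    ∑' k, ‖V k φ‖ₑ ^ 2 ≤ krausNorm G V E * ‖(φ : H)‖ₑ ^ 2 +
      ENNReal.ofReal (2 / E) * krausNorm G V E * ‖sqrtOp G φ‖ₑ ^ 2 := by
  have hunit : ∀ u : (sqrtOp G).domain, ‖(u : H)‖ₑ ^ 2 = 1 →
      ∑' k, ‖V k u‖ₑ ^ 2 ≤ krausNorm G V E +
        ENNReal.ofReal (2 / E) * krausNorm G V E * ‖sqrtOp G u‖ₑ ^ 2 := by
    intro u hu
    have h1 : ∑' k, ‖V k u‖ₑ ^ 2 ≤ krausNorm G V (‖sqrtOp G u‖ ^ 2) := by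
      simpa using tsum_enorm_sq_le_krausNorm hG hV (E := ‖sqrtOp G u‖ ^ 2)
        (φ := fun _ : Unit => u) (by simpa using hu)
        (by rw [tsum_fintype (L := .unconditional _), Fintype.sum_unique, enorm_sq_eq_ofReal])
    rcases le_total (‖sqrtOp G u‖ ^ 2) E with h | h
    · exact (h1.trans (krausNorm_mono h)).trans le_self_add
    · refine (h1.trans (ofReal_mul_krausNorm_le hG hG0 hV hE h)).trans (le_trans (le_of_eq ?_)
        le_add_self)
      rw [enorm_sq_eq_ofReal, mul_right_comm, ← ENNReal.ofReal_mul (by positivity)]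
      congr 2
      ring
  by_cases h0 : φ = 0
  · simp [h0]
  have hn : 0 < ‖(φ : H)‖ ^ 2 := by
    have : ‖(φ : H)‖ ≠ 0 := by simpa using h0
    positivity
  have hφ : φ = ((√(‖(φ : H)‖ ^ 2) : ℝ) : ℂ) • ((√((‖(φ : H)‖ ^ 2)⁻¹) : ℝ) : ℂ) • φ := by
    rw [smul_smul, ← Complex.ofReal_mul, ← Real.sqrt_mul hn.le, mul_inv_cancel₀ hn.ne']
    simp
  set u : (sqrtOp G).domain := ((√((‖(φ : H)‖ ^ 2)⁻¹) : ℝ) : ℂ) • φ with hu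
  have hu1 : ‖(u : H)‖ₑ ^ 2 = 1 := by
    rw [hu, Submodule.coe_smul, enorm_sqrt_smul_sq (by positivity), enorm_sq_eq_ofReal,
      ← ENNReal.ofReal_mul (by positivity), inv_mul_cancel₀ hn.ne']
    simp
  have h2 : ∀ k, ‖V k φ‖ₑ ^ 2 = ‖(φ : H)‖ₑ ^ 2 * ‖V k u‖ₑ ^ 2 := fun k => by
    conv_lhs => rw [hφ, map_smul]
    rw [enorm_sqrt_smul_sq hn.le, enorm_sq_eq_ofReal (φ : H)]
  have h3 : ‖sqrtOp G φ‖ₑ ^ 2 = ‖(φ : H)‖ₑ ^ 2 * ‖sqrtOp G u‖ₑ ^ 2 := by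
    conv_lhs => rw [hφ, LinearPMap.map_smul]
    rw [enorm_sqrt_smul_sq hn.le, enorm_sq_eq_ofReal (φ : H)]
  simp only [h2]
  rw [ENNReal.tsum_mul_left, h3]
  refine (mul_le_mul_right (hunit u hu1) _).trans (le_of_eq ?_)
  ring

/-- The Kraus series holds for all positive operators of finite trace and energy, by scaling. -/
theorem IsKraus.hasSum (hG : IsPosSelfAdjoint G) {V : κ → (sqrtOp G).domain →ₗ[ℂ] K}
    (hV : ∀ k, IsRelBounded G (V k)) {Φ : EnergyMap G K} (hK : IsKraus G Φ V)
    {ρ : H →L[ℂ] H} (hρ : ρ.IsPositive) (ht : posTrace ρ ≠ ⊤) (hE : energy G ρ ≠ ⊤) :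
    ∃ h : ρ ∈ finiteEnergySpan G,
      HasSum (fun k => sandwich G (V k) ρ) (Φ ⟨ρ, h⟩ : K →L[ℂ] K) := by
  obtain ⟨φ, hφ⟩ := exists_decomposition_of_energy_ne_top hG hρ ht hE
  have hsand := fun k => hasSum_sandwich hG (hV k) hφ ht hE
  set t : ℝ := (posTrace ρ).toReal with htdef
  have hpt : posTrace ρ = ENNReal.ofReal t := (ENNReal.ofReal_toReal ht).symm
  have ht0 : 0 ≤ t := ENNReal.toReal_nonneg
  clear_value t
  -- a nonzero `ρ` is a multiple of a state
  rcases ht0.eq_or_lt with h0 | hpos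
  · have hφ0 : ∀ i, φ i = 0 := by
      rw [← h0, ENNReal.ofReal_zero, posTrace_of_hasSum hφ, ENNReal.tsum_eq_zero] at hpt
      intro i
      simpa using hpt i
    have hρ0 : ρ = 0 := by
      refine hφ.unique ?_
      simp [hφ0]
    have hs0 : ∀ k, sandwich G (V k) ρ = 0 := by
      intro k
      refine (hsand k).unique ?_
      simp [hφ0]
    have hmem : ρ ∈ finiteEnergySpan G := by rw [hρ0]; exact zero_mem _
    refine ⟨hmem, ?_⟩
    have : (⟨ρ, hmem⟩ : finiteEnergySpan G) = 0 := Subtype.ext hρ0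
    simp only [hs0, this, map_zero]
    exact hasSum_zero
  have hti : 0 ≤ t⁻¹ := by positivity
  set ρ' : H →L[ℂ] H := ((t⁻¹ : ℝ) : ℂ) • ρ with hρ'
  have hφ' : HasSum (fun i => rankOne ℂ (((((√t⁻¹ : ℝ) : ℂ) • φ i : (sqrtOp G).domain)) : H)
      (((((√t⁻¹ : ℝ) : ℂ) • φ i : (sqrtOp G).domain)) : H)) ρ' :=
    hasSum_rankOne_sqrt_smul hφ hti
  have htr : posTrace ρ' = 1 := by
    rw [posTrace_of_hasSum hφ']
    simp only [Submodule.coe_smul, enorm_sqrt_smul_sq hti]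
    rw [ENNReal.tsum_mul_left, ← posTrace_of_hasSum hφ, hpt, ← ENNReal.ofReal_mul hti,
      inv_mul_cancel₀ hpos.ne', ENNReal.ofReal_one]
  have hE' : energy G ρ' < ⊤ := by
    rw [energy_of_hasSum hG hφ']
    simp only [LinearPMap.map_smul, enorm_sqrt_smul_sq hti]
    rw [ENNReal.tsum_mul_left, ← energy_of_hasSum hG hφ]
    exact ENNReal.mul_lt_top ENNReal.ofReal_lt_top hE.lt_top
  have hst : ρ' ∈ finiteEnergyStates G := ⟨⟨isPositive_of_hasSum hφ', htr⟩, hE'⟩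
  have hs' : ∀ k, sandwich G (V k) ρ' = ((t⁻¹ : ℝ) : ℂ) • sandwich G (V k) ρ := by
    intro k
    have h1 := hasSum_sandwich hG (hV k) hφ' (by rw [htr]; exact ENNReal.one_ne_top) hE'.ne
    simp only [LinearMap.map_smul] at h1
    have h2 := hasSum_rankOne_sqrt_smul (hsand k) hti
    exact h1.unique h2
  have hlim : HasSum (fun k => sandwich G (V k) ρ')
      (Φ ⟨ρ', Submodule.subset_span hst⟩ : K →L[ℂ] K) := by
    rw [HasSum, tendsto_iff_edist_tendsto_0]
    refine tendsto_of_tendsto_of_tendsto_of_le_of_le tendsto_const_nhds (hK ρ' hst)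
      (fun _ => zero_le) fun s => ?_
    rw [edist_comm, edist_eq_enorm_sub]
    exact enorm_le_traceNorm _
  have hback : ρ = (t : ℂ) • ρ' := by
    rw [hρ', smul_smul, ← Complex.ofReal_mul, mul_inv_cancel₀ hpos.ne', Complex.ofReal_one,
      one_smul]
  have hmem : ρ ∈ finiteEnergySpan G := by
    rw [hback]
    exact Submodule.smul_mem _ _ (Submodule.subset_span hst)
  refine ⟨hmem, ?_⟩
  have heq : (⟨ρ, hmem⟩ : finiteEnergySpan G) = (t : ℂ) • ⟨ρ', Submodule.subset_span hst⟩ :=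
    Subtype.ext hback
  rw [heq, map_smul]
  convert hlim.const_smul (t : ℂ) using 2 with k
  · rw [hs', smul_smul, ← Complex.ofReal_mul, mul_inv_cancel₀ hpos.ne', Complex.ofReal_one,
      one_smul]
  · rfl

end Kraus

end ECD

/-! ### The Hilbert space tensor product, slices and partial traces -/

namespace ECD

section Tensor

variable {H : Type*} [NormedAddCommGroup H] [InnerProductSpace ℂ H]
variable {R : Type*} [NormedAddCommGroup R] [InnerProductSpace ℂ R]
variable {ι κ : Type*}

/-- The operator `|a⟩ ⊗ I : r ↦ a ⊗ r` from `R` to `H ⊗ R`. -/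
noncomputable def tensorLeft (R : Type*) [NormedAddCommGroup R] [InnerProductSpace ℂ R] (a : H) :
    R →L[ℂ] HTensor H R :=
  (UniformSpace.Completion.toComplL (𝕜 := ℂ) (E := H ⊗[ℂ] R)).comp (TensorProduct.mkL ℂ H R a)

theorem tensorLeft_apply (a : H) (r : R) : tensorLeft R a r = tensorRight H r a := rfl

theorem inner_tensorRight (a b : H) (r s : R) :
    ⟪tensorRight H r a, tensorRight H s b⟫_ℂ = ⟪a, b⟫_ℂ * ⟪r, s⟫_ℂ := by
  rw [← TensorProduct.inner_tmul]
  exact UniformSpace.Completion.inner_coe _ _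

theorem norm_tensorRight_apply (a : H) (r : R) : ‖tensorRight H r a‖ = ‖a‖ * ‖r‖ := by
  rw [← TensorProduct.norm_tmul (𝕜 := ℂ)]
  exact UniformSpace.Completion.norm_coe _

theorem tensorRight_add (r s : R) : tensorRight H (r + s) = tensorRight H r + tensorRight H s := by
  ext a
  exact map_add (tensorLeft R a) r s

theorem tensorRight_smul (c : ℂ) (r : R) : tensorRight H (c • r) = c • tensorRight H r := by
  ext a
  exact map_smul (tensorLeft R a) c r

theorem topologicalClosure_span_tensorRight :
    (Submodule.span ℂ {x : HTensor H R | ∃ a r, tensorRight H r a = x}).topologicalClosure =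
      ⊤ := by
  rw [eq_top_iff]
  rintro x -
  refine UniformSpace.Completion.induction_on (p := fun x =>
    x ∈ (Submodule.span ℂ
      {x : HTensor H R | ∃ a r, tensorRight H r a = x}).topologicalClosure) x
    (Submodule.isClosed_topologicalClosure _) fun t => ?_
  apply Submodule.le_topologicalClosure
  induction t using TensorProduct.induction_on with
  | zero => exact zero_mem _
  | tmul a r => exact Submodule.subset_span ⟨a, r, rfl⟩
  | add x y hx hy =>
    rw [UniformSpace.Completion.coe_add]
    exact add_mem hx hy

/-- `I ⊗ |r⟩` for a unit vector `r`, as an isometry. -/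
noncomputable def tensorRightₗᵢ (H : Type*) [NormedAddCommGroup H] [InnerProductSpace ℂ H] (r : R)
    (hr : ‖r‖ = 1) : H →ₗᵢ[ℂ] HTensor H R where
  toLinearMap := (tensorRight H r : H →ₗ[ℂ] HTensor H R)
  norm_map' a := by
    change ‖tensorRight H r a‖ = ‖a‖
    rw [norm_tensorRight_apply, hr, mul_one]

/-- For an orthonormal basis `(eᵢ)` of `R`, the space `H ⊗ R` is the Hilbert sum of the spaces
`H ⊗ eᵢ`. -/
theorem isHilbertSum_tensorRight [CompleteSpace H] (e : HilbertBasis ι ℂ R) :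
    IsHilbertSum ℂ (fun _ : ι => H) fun i => tensorRightₗᵢ H (e i) (e.orthonormal.1 i) := by
  refine IsHilbertSum.mk (fun i j hij a b => ?_) ?_
  · change ⟪tensorRight H (e i) a, tensorRight H (e j) b⟫_ℂ = 0
    rw [inner_tensorRight, e.orthonormal.2 hij, mul_zero]
  · rw [← topologicalClosure_span_tensorRight]
    refine Submodule.topologicalClosure_minimal _ (Submodule.span_le.2 ?_)
      (Submodule.isClosed_topologicalClosure _)
    rintro _ ⟨a, r, rfl⟩
    rw [← tensorLeft_apply]
    set M := (⨆ i, LinearMap.range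
      (tensorRightₗᵢ H (e i) (e.orthonormal.1 i)).toLinearMap).topologicalClosure with hM
    have h1 : (Submodule.span ℂ (Set.range e)).topologicalClosure ≤
        M.comap (tensorLeft R a : R →ₗ[ℂ] HTensor H R) := by
      refine Submodule.topologicalClosure_minimal _ (Submodule.span_le.2 ?_) ?_
      · rintro _ ⟨i, rfl⟩
        exact Submodule.le_topologicalClosure _ (Submodule.mem_iSup_of_mem i ⟨a, rfl⟩)
      · exact (Submodule.isClosed_topologicalClosure _).preimage (tensorLeft R a).continuous
    rw [e.dense_span] at h1
    exact h1 (Submodule.mem_top (x := r))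

theorem linearIsometryEquiv_tensorRight_apply [CompleteSpace H] (e : HilbertBasis ι ℂ R)
    (Ω : HTensor H R) (i : ι) :
    (isHilbertSum_tensorRight e).linearIsometryEquiv Ω i =
      ContinuousLinearMap.adjoint (tensorRight H (e i)) Ω := by
  classical
  apply ext_inner_left ℂ
  intro a
  rw [ContinuousLinearMap.adjoint_inner_right]
  refine (lp.inner_single_left (𝕜 := ℂ) (G := fun _ : ι => H) i a _).symm.trans ?_
  rw [← LinearIsometryEquiv.inner_map_map (isHilbertSum_tensorRight e).linearIsometryEquiv.symm,
    LinearIsometryEquiv.symm_apply_apply, IsHilbertSum.linearIsometryEquiv_symm_apply_single]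
  rfl

theorem tsum_enorm_adjoint_tensorRight_sq [CompleteSpace H] (e : HilbertBasis ι ℂ R)
    (Ω : HTensor H R) :
    ∑' i, ‖ContinuousLinearMap.adjoint (tensorRight H (e i)) Ω‖ₑ ^ 2 = ‖Ω‖ₑ ^ 2 := by
  set f := (isHilbertSum_tensorRight e).linearIsometryEquiv Ω with hf
  have h1 : HasSum (fun i => ‖f i‖ ^ 2) (‖Ω‖ ^ 2) := by
    have h2 := lp.hasSum_norm (p := 2) (by norm_num) f
    have h3 : ‖f‖ = ‖Ω‖ := LinearIsometryEquiv.norm_map _ _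
    simpa [h3] using h2
  simp only [← linearIsometryEquiv_tensorRight_apply, ← hf, enorm_sq_eq_ofReal]
  rw [← ENNReal.ofReal_tsum_of_nonneg (fun _ => sq_nonneg _) h1.summable, h1.tsum_eq]

theorem memℓp_two_of_tsum_ne_top {H : Type*} [NormedAddCommGroup H] {a : ι → H} (ha : ∑' i, ‖a i‖ₑ ^ 2 ≠ ⊤) :
    Memℓp (E := fun _ : ι => H) a 2 := by
  rw [memℓp_gen_iff (by norm_num)]
  simpa using tsum_enorm_sq_ne_top_iff.1 ha

/-- A pointwise square-summable family of operators `Vᵢ` assembles to `φ ↦ ∑ᵢ Vᵢ φ ⊗ eᵢ`. -/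
theorem exists_linearMap_tensor [CompleteSpace H] (e : HilbertBasis ι ℂ R) {M : Type*}
    [AddCommGroup M] [Module ℂ M] (V : ι → M →ₗ[ℂ] H) (hV : ∀ φ, ∑' i, ‖V i φ‖ₑ ^ 2 ≠ ⊤) :
    ∃ W : M →ₗ[ℂ] HTensor H R,
      ∀ i φ, ContinuousLinearMap.adjoint (tensorRight H (e i)) (W φ) = V i φ := by
  let U := (isHilbertSum_tensorRight (H := H) e).linearIsometryEquiv
  let F : M →ₗ[ℂ] lp (fun _ : ι => H) 2 :=
    { toFun := fun φ => ⟨fun i => V i φ, memℓp_two_of_tsum_ne_top (hV φ)⟩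
      map_add' := fun φ χ => by ext i; exact map_add (V i) φ χ
      map_smul' := fun c φ => by ext i; exact map_smul (V i) c φ }
  refine ⟨(U.symm.toLinearEquiv : lp (fun _ : ι => H) 2 →ₗ[ℂ] HTensor H R) ∘ₗ F, fun i φ => ?_⟩
  rw [← linearIsometryEquiv_tensorRight_apply]
  change U (U.symm (F φ)) i = _
  rw [LinearIsometryEquiv.apply_symm_apply]
  rfl

theorem exists_tensor_of_tsum_ne_top [CompleteSpace H] (e : HilbertBasis ι ℂ R) {a : ι → H}
    (ha : ∑' i, ‖a i‖ₑ ^ 2 ≠ ⊤) :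
    ∃ Ω : HTensor H R, ∀ i, ContinuousLinearMap.adjoint (tensorRight H (e i)) Ω = a i := by
  refine ⟨(isHilbertSum_tensorRight e).linearIsometryEquiv.symm
    ⟨a, memℓp_two_of_tsum_ne_top ha⟩, fun i => ?_⟩
  rw [← linearIsometryEquiv_tensorRight_apply, LinearIsometryEquiv.apply_symm_apply]

theorem hasSum_adjoint_tensorRight [CompleteSpace H] (e : HilbertBasis ι ℂ R)
    (Ω : HTensor H R) (r : R) :
    HasSum (fun i => ⟪r, e i⟫_ℂ • ContinuousLinearMap.adjoint (tensorRight H (e i)) Ω)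
      (ContinuousLinearMap.adjoint (tensorRight H r) Ω) := by
  have h1 := ((isHilbertSum_tensorRight e).hasSum_linearIsometryEquiv_symm
    ((isHilbertSum_tensorRight e).linearIsometryEquiv Ω)).mapL
    (ContinuousLinearMap.adjoint (tensorRight H r))
  rw [LinearIsometryEquiv.symm_apply_apply] at h1
  refine h1.congr_fun fun i => ?_
  rw [linearIsometryEquiv_tensorRight_apply]
  apply ext_inner_left ℂ
  intro a
  rw [ContinuousLinearMap.adjoint_inner_right, inner_smul_right, mul_comm]
  exact (inner_tensorRight _ _ _ _).symm

theorem eq_of_ofReal_re_inner_eq {σ τ : H →L[ℂ] H} (hσ : σ.IsPositive) (hτ : τ.IsPositive)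
    (h : ∀ x, ENNReal.ofReal (⟪x, σ x⟫_ℂ).re = ENNReal.ofReal (⟪x, τ x⟫_ℂ).re) : σ = τ := by
  have hre : ∀ x, (⟪x, σ x⟫_ℂ).re = (⟪x, τ x⟫_ℂ).re := fun x =>
    (ENNReal.ofReal_eq_ofReal_iff (hσ.re_inner_nonneg_right x) (hτ.re_inner_nonneg_right x)).1 (h x)
  have him : ∀ {ρ : H →L[ℂ] H}, ρ.IsPositive → ∀ x, (⟪x, ρ x⟫_ℂ).im = 0 := by
    intro ρ hρ x
    have := hρ.isSymmetric x x
    change ⟪ρ x, x⟫_ℂ = ⟪x, ρ x⟫_ℂ at this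
    rw [← inner_conj_symm] at this
    exact Complex.conj_eq_iff_im.1 this
  have h1 : (σ : H →ₗ[ℂ] H) = τ := by
    refine (ext_inner_map _ _).1 fun x => ?_
    change ⟪σ x, x⟫_ℂ = ⟪τ x, x⟫_ℂ
    rw [← inner_conj_symm, ← inner_conj_symm (τ x)]
    congr 1
    exact Complex.ext (hre x) (by rw [him hσ, him hτ])
  exact ContinuousLinearMap.coe_injective h1

variable [CompleteSpace H]

theorem hasSum_slice {Ω : ι → HTensor H R} {ω : HTensor H R →L[ℂ] HTensor H R}
    (h : HasSum (fun n => rankOne ℂ (Ω n) (Ω n)) ω) (r : R) :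
    HasSum (fun n => rankOne ℂ (ContinuousLinearMap.adjoint (tensorRight H r) (Ω n))
      (ContinuousLinearMap.adjoint (tensorRight H r) (Ω n))) (slice ω r r) := by
  have := hasSum_rankOne_map h (ContinuousLinearMap.adjoint (tensorRight H r))
  rwa [ContinuousLinearMap.adjoint_adjoint] at this

theorem slice_polarization (ω : HTensor H R →L[ℂ] HTensor H R) (r s : R) :
    slice ω r s = (4⁻¹ : ℂ) • (slice ω (r + s) (r + s) - slice ω (r + (-1 : ℂ) • s)
      (r + (-1 : ℂ) • s) - Complex.I • slice ω (r + Complex.I • s) (r + Complex.I • s) +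
      Complex.I • slice ω (r + (-Complex.I) • s) (r + (-Complex.I) • s)) := by
  ext a
  simp only [slice, tensorRight_add, tensorRight_smul, map_add, LinearIsometryEquiv.map_smulₛₗ,
    ContinuousLinearMap.comp_apply, add_apply, smul_apply, sub_apply, map_smul, map_neg, map_one,
    Complex.conj_I, smul_add, smul_sub, smul_smul]
  match_scalars <;> ring_nf <;> norm_num [Complex.I_sq]

/-- An operator on `H ⊗ R` is determined by its slices: product vectors span a dense subspace. -/
theorem ext_slice {T T' : HTensor H R →L[ℂ] HTensor H R}
    (h : ∀ r s : R, slice T r s = slice T' r s) : T = T' := by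
  have hext : ∀ {x y : HTensor H R},
      (∀ a (r : R), ⟪tensorRight H r a, x⟫_ℂ = ⟪tensorRight H r a, y⟫_ℂ) → x = y := by
    intro x y hxy
    have h1 : x - y ∈ (Submodule.span ℂ
        {x : HTensor H R | ∃ a r, tensorRight H r a = x})ᗮ := by
      rw [Submodule.mem_orthogonal]
      intro u hu
      induction hu using Submodule.span_induction with
      | mem u hu =>
        obtain ⟨a, r, rfl⟩ := hu
        rw [inner_sub_right, hxy, sub_self]
      | zero => rw [inner_zero_left]
      | add u v _ _ hu hv => rw [inner_add_left, hu, hv, add_zero]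
      | smul c u _ hu => rw [inner_smul_left, hu, mul_zero]
    rw [Submodule.topologicalClosure_eq_top_iff.1 topologicalClosure_span_tensorRight] at h1
    exact sub_eq_zero.1 ((Submodule.mem_bot ℂ).1 h1)
  have h2 : ∀ b (s : R), T (tensorRight H s b) = T' (tensorRight H s b) := by
    intro b s
    refine hext fun a r => ?_
    rw [← ContinuousLinearMap.adjoint_inner_right, ← ContinuousLinearMap.adjoint_inner_right]
    exact congrArg (fun x => ⟪a, x⟫_ℂ) (DFunLike.congr_fun (h r s) b)
  refine ContinuousLinearMap.ext_on
    (s := {x : HTensor H R | ∃ a r, tensorRight H r a = x}) ?_ ?_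
  · exact Submodule.dense_iff_topologicalClosure_eq_top.2 topologicalClosure_span_tensorRight
  · rintro _ ⟨a, r, rfl⟩
    exact h2 a r

theorem tsum_enorm_adjoint_tensorRight_prod_sq (e : HilbertBasis κ ℂ R) (Ω : ι → HTensor H R) :
    ∑' p : ι × κ, ‖ContinuousLinearMap.adjoint (tensorRight H (e p.2)) (Ω p.1)‖ₑ ^ 2 =
      ∑' n, ‖Ω n‖ₑ ^ 2 := by
  rw [ENNReal.tsum_prod' (f := fun p : ι × κ => ‖ContinuousLinearMap.adjoint
    (tensorRight H (e p.2)) (Ω p.1)‖ₑ ^ 2)]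
  simp only [tsum_enorm_adjoint_tensorRight_sq]

variable [CompleteSpace R]

theorem tsum_enorm_inner_adjoint_tensorRight_sq (e : HilbertBasis ι ℂ R) (Ω : HTensor H R)
    (x : H) :
    ∑' i, ‖⟪x, ContinuousLinearMap.adjoint (tensorRight H (e i)) Ω⟫_ℂ‖ₑ ^ 2 =
      ‖ContinuousLinearMap.adjoint (tensorLeft R x) Ω‖ₑ ^ 2 := by
  rw [← tsum_enorm_inner_sq_eq e]
  simp only [ContinuousLinearMap.adjoint_inner_right, tensorLeft_apply]

/-- The partial trace of `∑ₙ |Ωₙ⟩⟨Ωₙ|`, computed in any orthonormal basis `(eᵢ)` of `R`. It does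
not depend on the basis because its quadratic form is `∑ₙ ‖(⟨x| ⊗ I) Ωₙ‖²`. -/
theorem hasSum_partialTrace (e : HilbertBasis κ ℂ R) {Ω : ι → HTensor H R}
    {ω : HTensor H R →L[ℂ] HTensor H R}
    (h : HasSum (fun n => rankOne ℂ (Ω n) (Ω n)) ω) (ht : posTrace ω ≠ ⊤) :
    HasSum (fun p : ι × κ => rankOne ℂ
      (ContinuousLinearMap.adjoint (tensorRight H (e p.2)) (Ω p.1))
      (ContinuousLinearMap.adjoint (tensorRight H (e p.2)) (Ω p.1))) (partialTrace ω) := by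
  rw [posTrace_of_hasSum h] at ht
  obtain ⟨σ, hσ⟩ := summable_rankOne (ψ := fun p : ι × κ => ContinuousLinearMap.adjoint
    (tensorRight H (e p.2)) (Ω p.1)) (by rwa [tsum_enorm_adjoint_tensorRight_prod_sq])
  obtain ⟨τ, hτ⟩ := summable_rankOne (ψ := fun p : ι × BasisIndex R =>
    ContinuousLinearMap.adjoint (tensorRight H (onb R p.2)) (Ω p.1))
    (by rwa [tsum_enorm_adjoint_tensorRight_prod_sq])
  have hτ' : partialTrace ω = τ :=
    (((Equiv.prodComm _ _).hasSum_iff.2 hτ).prod_fiberwise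
      fun i => hasSum_slice h (onb R i)).tsum_eq
  have hστ : σ = τ := by
    refine eq_of_ofReal_re_inner_eq (isPositive_of_hasSum hσ) (isPositive_of_hasSum hτ) fun x => ?_
    rw [ofReal_re_inner_of_hasSum hσ, ofReal_re_inner_of_hasSum hτ, ENNReal.tsum_prod'
      (f := fun p : ι × κ => ‖⟪x, ContinuousLinearMap.adjoint
        (tensorRight H (e p.2)) (Ω p.1)⟫_ℂ‖ₑ ^ 2), ENNReal.tsum_prod'
      (f := fun p : ι × BasisIndex R => ‖⟪x, ContinuousLinearMap.adjoint
        (tensorRight H (onb R p.2)) (Ω p.1)⟫_ℂ‖ₑ ^ 2)]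
    simp only [tsum_enorm_inner_adjoint_tensorRight_sq]
  rwa [hτ', ← hστ]

end Tensor

end ECD

/-! ### The amplification of a map with a Kraus family -/

namespace ECD

section Amplification

variable {H : Type*} [NormedAddCommGroup H] [InnerProductSpace ℂ H] [CompleteSpace H]
variable {K : Type*} [NormedAddCommGroup K] [InnerProductSpace ℂ K] [CompleteSpace K]
variable {R : Type*} [NormedAddCommGroup R] [InnerProductSpace ℂ R]
variable {ι : Type*} {κ : Type} {G : H →ₗ.[ℂ] H}

theorem enorm_adjoint_tensorRight_sq_le (r : R) (Ω : HTensor H R) :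
    ‖ContinuousLinearMap.adjoint (tensorRight H r) Ω‖ₑ ^ 2 ≤ ‖r‖ₑ ^ 2 * ‖Ω‖ₑ ^ 2 := by
  rw [← mul_pow]
  gcongr
  refine (ContinuousLinearMap.le_opENorm _ _).trans ?_
  gcongr
  rw [LinearIsometryEquiv.enorm_map, ← ofReal_norm, ← ofReal_norm]
  refine ENNReal.ofReal_le_ofReal (ContinuousLinearMap.opNorm_le_bound _ (norm_nonneg _) fun a => ?_)
  rw [norm_tensorRight_apply, mul_comm]

theorem tsum_enorm_adjoint_tensorRight_sq_ne_top (r : R) {Ω : ι → HTensor H R}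
    (h : ∑' n, ‖Ω n‖ₑ ^ 2 ≠ ⊤) :
    ∑' n, ‖ContinuousLinearMap.adjoint (tensorRight H r) (Ω n)‖ₑ ^ 2 ≠ ⊤ := by
  refine ne_top_of_le_ne_top ?_
    (ENNReal.tsum_le_tsum fun n => enorm_adjoint_tensorRight_sq_le r (Ω n))
  rw [ENNReal.tsum_mul_left]
  exact ENNReal.mul_ne_top (by finiteness) h

theorem isRelBounded_sqrtOp : IsRelBounded G (sqrtOp G).toFun :=
  ⟨0, 1, le_rfl, zero_le_one, fun φ => by simp⟩

/-- Let `Ψ` have the components `(1 + √G) φᵢ`, where the `φᵢ` are the components of `Ω` in an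
orthonormal basis of `R`. Then all partial inner products `(I ⊗ ⟨r|) Ω` lie in `D(√G)`. -/
theorem resolventEquiv_symm_adjoint_tensorRight (hG : IsPosSelfAdjoint G) (e : HilbertBasis ι ℂ R)
    {Ω Ψ : HTensor H R} {φ : ι → (sqrtOp G).domain}
    (hφ : ∀ i, (φ i : H) = ContinuousLinearMap.adjoint (tensorRight H (e i)) Ω)
    (hΨ : ∀ i, ContinuousLinearMap.adjoint (tensorRight H (e i)) Ψ = resolventEquiv hG (φ i))
    (r : R) :
    ((resolventEquiv hG).symm (ContinuousLinearMap.adjoint (tensorRight H r) Ψ) : H) =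
      ContinuousLinearMap.adjoint (tensorRight H r) Ω := by
  have h := (hasSum_adjoint_tensorRight e Ψ r).mapL (resolvent hG)
  simp only [hΨ, map_smul, resolvent_resolventEquiv, hφ] at h
  exact h.unique (hasSum_adjoint_tensorRight e Ω r)

/-- A vector `X` with the components `V φᵢ` satisfies `(I ⊗ ⟨r|) X = V (I ⊗ ⟨r|) Ω`; it is
`(V ⊗ I) Ω`. -/
theorem adjoint_tensorRight_eq_map (hG : IsPosSelfAdjoint G) (e : HilbertBasis ι ℂ R)
    {Ψ : HTensor H R} {φ : ι → (sqrtOp G).domain}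
    (hΨ : ∀ i, ContinuousLinearMap.adjoint (tensorRight H (e i)) Ψ = resolventEquiv hG (φ i))
    {V : (sqrtOp G).domain →ₗ[ℂ] K} (hV : IsRelBounded G V) {X : HTensor K R}
    (hX : ∀ i, ContinuousLinearMap.adjoint (tensorRight K (e i)) X = V (φ i)) (r : R) :
    ContinuousLinearMap.adjoint (tensorRight K r) X =
      V ((resolventEquiv hG).symm (ContinuousLinearMap.adjoint (tensorRight H r) Ψ)) := by
  obtain ⟨W, hW⟩ := hV.exists_comp_resolvent hG
  have h := (hasSum_adjoint_tensorRight e Ψ r).mapL W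
  simp only [hΨ, map_smul, hW, ← hX] at h
  rw [(hasSum_adjoint_tensorRight e X r).unique h, ← hW, LinearEquiv.apply_symm_apply]

theorem IsAmplification.unique {Φ : EnergyMap G K} {ω : HTensor H R →L[ℂ] HTensor H R}
    {T T' : HTensor K R →L[ℂ] HTensor K R} (h : IsAmplification G Φ ω T)
    (h' : IsAmplification G Φ ω T') : T = T' := by
  refine ext_slice fun r s => ?_
  obtain ⟨_, h1⟩ := h.2 r s
  obtain ⟨_, h2⟩ := h'.2 r s
  rw [h1, h2]

theorem IsAmplification.amplify_eq {Φ : EnergyMap G K} {ω : HTensor H R →L[ℂ] HTensor H R}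
    {T : HTensor K R →L[ℂ] HTensor K R} (h : IsAmplification G Φ ω T) : amplify G Φ ω = T :=
  IsAmplification.unique (Classical.epsilon_spec ⟨T, h⟩) h

/-- By polarization, an amplification need only be checked on the diagonal slices. -/
theorem isAmplification_of_diagonal {Φ : EnergyMap G K} {ω : HTensor H R →L[ℂ] HTensor H R}
    {T : HTensor K R →L[ℂ] HTensor K R} (hT : traceNorm T ≠ ⊤)
    (h : ∀ r : R, ∃ h : slice ω r r ∈ finiteEnergySpan G,
      slice T r r = (Φ ⟨slice ω r r, h⟩ : K →L[ℂ] K)) : IsAmplification G Φ ω T := by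
  choose hm hd using h
  refine ⟨hT.lt_top, fun r s => ?_⟩
  let q : R → finiteEnergySpan G := fun r => ⟨slice ω r r, hm r⟩
  let p : finiteEnergySpan G := (4⁻¹ : ℂ) • (q (r + s) - q (r + (-1 : ℂ) • s) -
    Complex.I • q (r + Complex.I • s) + Complex.I • q (r + (-Complex.I) • s))
  have hp : (p : H →L[ℂ] H) = slice ω r s := (slice_polarization ω r s).symm
  have hmem : slice ω r s ∈ finiteEnergySpan G := hp ▸ p.2
  refine ⟨hmem, ?_⟩
  have hp' : (⟨slice ω r s, hmem⟩ : finiteEnergySpan G) = p := Subtype.ext hp.symm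
  rw [hp', slice_polarization, hd, hd, hd, hd]
  simp only [p, map_smul, map_add, map_sub]
  rfl

variable [CompleteSpace R]

/-- The components of a decomposition of `ω` decompose `ω_H = Tr_R ω`, so they lie in `D(√G)` when
`ω_H` has finite energy. -/
theorem exists_components (hG : IsPosSelfAdjoint G) {Ω : ι → HTensor H R}
    {ω : HTensor H R →L[ℂ] HTensor H R} (hω : HasSum (fun n => rankOne ℂ (Ω n) (Ω n)) ω)
    (ht : posTrace ω ≠ ⊤) (hE : energy G (partialTrace ω) ≠ ⊤) :
    ∃ φ : ι × BasisIndex R → (sqrtOp G).domain,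
      ∀ p, (φ p : H) = ContinuousLinearMap.adjoint (tensorRight H (onb R p.2)) (Ω p.1) := by
  have h := hasSum_partialTrace (onb R) hω ht
  exact ⟨fun p => ⟨_, mem_domain_of_energy_ne_top hG h hE p⟩, fun p => rfl⟩

variable [TopologicalSpace.SeparableSpace H]

/-- The amplification at `ω = ∑ₙ |Ωₙ⟩⟨Ωₙ|` is `∑ₖ ∑ₙ |(Vₖ ⊗ I) Ωₙ⟩⟨(Vₖ ⊗ I) Ωₙ|`. It is positive, so
its trace norm is `∑ₖ ∑ₙ ‖(Vₖ ⊗ I) Ωₙ‖²`. -/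
theorem exists_isAmplification (hG : IsPosSelfAdjoint G)
    {V : κ → (sqrtOp G).domain →ₗ[ℂ] K} (hV : ∀ k, IsRelBounded G (V k)) {Φ : EnergyMap G K}
    (hK : IsKraus G Φ V) {Ω : ι → HTensor H R} {ω : HTensor H R →L[ℂ] HTensor H R}
    (hω : HasSum (fun n => rankOne ℂ (Ω n) (Ω n)) ω) (ht : posTrace ω ≠ ⊤)
    {φ : ι × BasisIndex R → (sqrtOp G).domain}
    (hφ : ∀ p, (φ p : H) = ContinuousLinearMap.adjoint (tensorRight H (onb R p.2)) (Ω p.1))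
    (hE : ∑' p, ‖sqrtOp G (φ p)‖ₑ ^ 2 ≠ ⊤) (hfin : ∑' k, ∑' p, ‖V k (φ p)‖ₑ ^ 2 ≠ ⊤) :
    ∃ T : HTensor K R →L[ℂ] HTensor K R, IsAmplification G Φ ω T ∧
      traceNorm T = ∑' k, ∑' p, ‖V k (φ p)‖ₑ ^ 2 := by
  rw [posTrace_of_hasSum hω] at ht
  rw [ENNReal.tsum_prod' (f := fun p : ι × BasisIndex R => ‖sqrtOp G (φ p)‖ₑ ^ 2)] at hE
  have hEn : ∀ n, ∑' i, ‖sqrtOp G (φ (n, i))‖ₑ ^ 2 ≠ ⊤ := fun n =>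
    ne_top_of_le_ne_top hE (ENNReal.le_tsum (f := fun n => ∑' i, ‖sqrtOp G (φ (n, i))‖ₑ ^ 2) n)
  have h0n : ∀ n, ∑' i, ‖(φ (n, i) : H)‖ₑ ^ 2 ≠ ⊤ := fun n => by
    simp only [hφ, tsum_enorm_adjoint_tensorRight_sq]
    finiteness
  choose Ψ hΨ using fun n => exists_tensor_of_tsum_ne_top (onb R)
    (tsum_enorm_resolventEquiv_sq_ne_top hG (h0n n) (hEn n))
  -- `χ n r = (I ⊗ ⟨r|) Ωₙ`
  let χ : ι → R → (sqrtOp G).domain := fun n r =>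
    (resolventEquiv hG).symm (ContinuousLinearMap.adjoint (tensorRight H r) (Ψ n))
  have hχ : ∀ n r, (χ n r : H) = ContinuousLinearMap.adjoint (tensorRight H r) (Ω n) :=
    fun n => resolventEquiv_symm_adjoint_tensorRight hG (onb R) (fun i => hφ (n, i)) (hΨ n)
  -- `X k n = (Vₖ ⊗ I) Ωₙ`
  choose X hX using fun k n => exists_tensor_of_tsum_ne_top (onb R)
    ((hV k).tsum_ne_top (h0n n) (hEn n))
  have hXn : ∀ k n, ‖X k n‖ₑ ^ 2 = ∑' i, ‖V k (φ (n, i))‖ₑ ^ 2 := fun k n => by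
    rw [← tsum_enorm_adjoint_tensorRight_sq (onb R)]
    simp only [hX]
  have hXsum : ∑' p : κ × ι, ‖X p.1 p.2‖ₑ ^ 2 = ∑' k, ∑' p, ‖V k (φ p)‖ₑ ^ 2 := by
    rw [ENNReal.tsum_prod' (f := fun p : κ × ι => ‖X p.1 p.2‖ₑ ^ 2)]
    refine tsum_congr fun k => ?_
    rw [ENNReal.tsum_prod' (f := fun p : ι × BasisIndex R => ‖V k (φ p)‖ₑ ^ 2)]
    exact tsum_congr fun n => hXn k n
  obtain ⟨T, hT⟩ := summable_rankOne (ψ := fun p : κ × ι => X p.1 p.2) (by rwa [hXsum])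
  have hTn : traceNorm T = ∑' k, ∑' p, ‖V k (φ p)‖ₑ ^ 2 := by
    rw [traceNorm_of_hasSum hT, hXsum]
  refine ⟨T, isAmplification_of_diagonal (by rwa [hTn]) fun r => ?_, hTn⟩
  have hs : HasSum (fun n => rankOne ℂ (χ n r : H) (χ n r : H)) (slice ω r r) := by
    simpa only [hχ] using hasSum_slice hω r
  have hst : posTrace (slice ω r r) ≠ ⊤ := by
    rw [posTrace_of_hasSum hs]
    simp only [hχ]
    exact tsum_enorm_adjoint_tensorRight_sq_ne_top r ht
  have hsE : energy G (slice ω r r) ≠ ⊤ := by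
    rw [energy_of_hasSum hG hs]
    -- `Y n = (√G ⊗ I) Ωₙ`
    choose Y hY using fun n => exists_tensor_of_tsum_ne_top (onb R) (hEn n)
    have hYn : ∀ n, ‖Y n‖ₑ ^ 2 = ∑' i, ‖sqrtOp G (φ (n, i))‖ₑ ^ 2 := fun n => by
      rw [← tsum_enorm_adjoint_tensorRight_sq (onb R)]
      simp only [hY]
    have hχS : ∀ n, sqrtOp G (χ n r) = ContinuousLinearMap.adjoint (tensorRight H r) (Y n) :=
      fun n => (adjoint_tensorRight_eq_map hG (onb R) (hΨ n) isRelBounded_sqrtOp (hY n) r).symm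
    simp only [hχS]
    exact tsum_enorm_adjoint_tensorRight_sq_ne_top r (by simpa only [hYn] using hE)
  obtain ⟨hmem, hΦ⟩ := hK.hasSum hG hV (isPositive_of_hasSum hs) hst hsE
  refine ⟨hmem, ?_⟩
  have h1 := hasSum_slice hT r
  simp only [fun k n => adjoint_tensorRight_eq_map hG (onb R) (hΨ n) (hV k) (hX k n) r] at h1
  exact (h1.prod_fiberwise fun k => hasSum_sandwich hG (hV k) hs hst hsE).unique hΦ

/-- At a state `ω`, the amplification exists and its trace norm is the Kraus functional at the
reduced state `Tr_R ω`. -/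
theorem exists_isAmplification_of_isState (hG : IsPosSelfAdjoint G) (hG0 : HasZeroInf G)
    {V : κ → (sqrtOp G).domain →ₗ[ℂ] K} (hV : ∀ k, IsRelBounded G (V k)) {Φ : EnergyMap G K}
    (hK : IsKraus G Φ V) {E₀ : ℝ} (hE₀ : 0 < E₀) (hfin : krausNorm G V E₀ < ⊤)
    {ω : HTensor H R →L[ℂ] HTensor H R} (hω : IsState ω) (hE : energy G (partialTrace ω) < ⊤) :
    ∃ T : HTensor K R →L[ℂ] HTensor K R, IsAmplification G Φ ω T ∧
      ∀ E, energy G (partialTrace ω) ≤ ENNReal.ofReal E → traceNorm T ≤ krausNorm G V E := by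
  have ht := hω.posTrace_ne_top
  obtain ⟨Ω, hΩ⟩ := exists_hasSum_rankOne_onb hω.1 ht
  obtain ⟨φ, hφ⟩ := exists_components hG hΩ ht hE.ne
  have hp := hasSum_partialTrace (onb R) hΩ ht
  simp only [← hφ] at hp
  have h1 : ∑' p, ‖(φ p : H)‖ₑ ^ 2 = 1 := by
    simp only [hφ]
    rw [tsum_enorm_adjoint_tensorRight_prod_sq, ← posTrace_of_hasSum hΩ, hω.2]
  have h2 := energy_of_hasSum hG hp
  have hle : ∀ E, energy G (partialTrace ω) ≤ ENNReal.ofReal E →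
      ∑' k, ∑' p, ‖V k (φ p)‖ₑ ^ 2 ≤ krausNorm G V E := fun E hE' =>
    tsum_enorm_sq_le_krausNorm hG hV h1 (by rwa [← h2])
  have hfin' : ∑' k, ∑' p, ‖V k (φ p)‖ₑ ^ 2 ≠ ⊤ :=
    ((hle (energy G (partialTrace ω)).toReal (ENNReal.ofReal_toReal hE.ne).ge).trans_lt
      (krausNorm_lt_top hG hG0 hV hE₀ hfin _)).ne
  obtain ⟨T, hT, hTn⟩ := exists_isAmplification hG hV hK hΩ ht hφ (by rw [← h2]; exact hE.ne) hfin'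
  exact ⟨T, hT, fun E hE' => hTn.le.trans (hle E hE')⟩

/-- The Kraus functional at `ρ` is attained at the product states `ρ ⊗ |r⟩⟨r|`. -/
theorem krausNorm_le_ecdNorm (hG : IsPosSelfAdjoint G) {V : κ → (sqrtOp G).domain →ₗ[ℂ] K}
    (hV : ∀ k, IsRelBounded G (V k)) {Φ : EnergyMap G K} (hK : IsKraus G Φ V) [Nontrivial R]
    {E : ℝ} (hfin : krausNorm G V E < ⊤) : krausNorm G V E ≤ ecdNorm G Φ R E := by
  refine krausNorm_le hG hV fun φ h1 h2 => ?_
  obtain ⟨r, hr⟩ := exists_norm_eq R zero_le_one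
  have hr' : ∑' i, ‖⟪onb R i, r⟫_ℂ‖ₑ ^ 2 = 1 := by
    rw [tsum_enorm_inner_sq_eq, enorm_sq_eq_ofReal, hr]
    simp
  set Ω : ℕ → HTensor H R := fun n => tensorRight H r (φ n) with hΩdef
  have hΩ1 : ∑' n, ‖Ω n‖ₑ ^ 2 = 1 := by
    rw [← h1]
    refine tsum_congr fun n => ?_
    rw [hΩdef, ← ofReal_norm, norm_tensorRight_apply, hr, mul_one, ofReal_norm]
  obtain ⟨ω, hω⟩ := summable_rankOne (ψ := Ω) (by rw [hΩ1]; exact ENNReal.one_ne_top)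
  have hst := isState_of_hasSum hω hΩ1
  let χ : ℕ × BasisIndex R → (sqrtOp G).domain := fun p => ⟪onb R p.2, r⟫_ℂ • φ p.1
  have hχ : ∀ p, (χ p : H) = ContinuousLinearMap.adjoint (tensorRight H (onb R p.2)) (Ω p.1) := by
    intro p
    apply ext_inner_left ℂ
    intro a
    rw [ContinuousLinearMap.adjoint_inner_right, inner_tensorRight, mul_comm]
    exact inner_smul_right _ _ _
  have hsumV : ∀ k, ∑' p, ‖V k (χ p)‖ₑ ^ 2 = ∑' n, ‖V k (φ n)‖ₑ ^ 2 := by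
    intro k
    simp only [χ, LinearMap.map_smul, enorm_smul, mul_pow]
    rw [ENNReal.tsum_prod' (f := fun p : ℕ × BasisIndex R =>
      ‖⟪onb R p.2, r⟫_ℂ‖ₑ ^ 2 * ‖V k (φ p.1)‖ₑ ^ 2)]
    simp only [ENNReal.tsum_mul_right, hr', one_mul]
  have hsumS : ∑' p, ‖sqrtOp G (χ p)‖ₑ ^ 2 = ∑' n, ‖sqrtOp G (φ n)‖ₑ ^ 2 := by
    simp only [χ, LinearPMap.map_smul, enorm_smul, mul_pow]
    rw [ENNReal.tsum_prod' (f := fun p : ℕ × BasisIndex R =>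
      ‖⟪onb R p.2, r⟫_ℂ‖ₑ ^ 2 * ‖sqrtOp G (φ p.1)‖ₑ ^ 2)]
    simp only [ENNReal.tsum_mul_right, hr', one_mul]
  have hp := hasSum_partialTrace (onb R) hω hst.posTrace_ne_top
  simp only [← hχ] at hp
  have hE : energy G (partialTrace ω) ≤ ENNReal.ofReal E := by
    rwa [energy_of_hasSum hG hp, hsumS]
  obtain ⟨T, hT, hTn⟩ := exists_isAmplification hG hV hK hω hst.posTrace_ne_top hχ
    (by rw [hsumS]; exact (h2.trans_lt ENNReal.ofReal_lt_top).ne)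
    (by simp only [hsumV]; exact ((tsum_enorm_sq_le_krausNorm hG hV h1 h2).trans_lt hfin).ne)
  simp only [hsumV] at hTn
  rw [← hTn, ← hT.amplify_eq]
  exact le_iSup_of_le ω (le_iSup_of_le hst (le_iSup_of_le hE le_rfl))

theorem krausNorm_eq_ecdNorm (hG : IsPosSelfAdjoint G) (hG0 : HasZeroInf G)
    {V : κ → (sqrtOp G).domain →ₗ[ℂ] K} (hV : ∀ k, IsRelBounded G (V k)) {Φ : EnergyMap G K}
    (hK : IsKraus G Φ V) [Nontrivial R] {E₀ : ℝ} (hE₀ : 0 < E₀) (hfin : krausNorm G V E₀ < ⊤)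
    (E : ℝ) : krausNorm G V E = ecdNorm G Φ R E := by
  refine le_antisymm
    (krausNorm_le_ecdNorm hG hV hK (krausNorm_lt_top hG hG0 hV hE₀ hfin E)) ?_
  refine iSup_le fun ω => iSup_le fun hω => iSup_le fun hE => ?_
  obtain ⟨T, hT, hTn⟩ := exists_isAmplification_of_isState hG hG0 hV hK hE₀ hfin hω
    (hE.trans_lt ENNReal.ofReal_lt_top)
  rw [hT.amplify_eq]
  exact hTn E hE

end Amplification

end ECD

/-! ### Stinespring operators and Kraus families -/

namespace ECD

section Cone

variable {H : Type*} [NormedAddCommGroup H] [InnerProductSpace ℂ H] [CompleteSpace H]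
variable {K : Type*} [NormedAddCommGroup K] [InnerProductSpace ℂ K]
variable {L : Type*} [NormedAddCommGroup L] [InnerProductSpace ℂ L]
variable {κ : Type} {G : H →ₗ.[ℂ] H}

theorem hasRelBound_iff_enorm {V : (sqrtOp G).domain →ₗ[ℂ] K} {a b : ℝ} :
    HasRelBound G V a b ↔ ∀ φ : (sqrtOp G).domain, ‖V φ‖ₑ ^ 2 ≤
      ENNReal.ofReal (a ^ 2) * ‖(φ : H)‖ₑ ^ 2 + ENNReal.ofReal (b ^ 2) * ‖sqrtOp G φ‖ₑ ^ 2 := by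
  refine forall_congr' fun φ => ?_
  simp only [enorm_sq_eq_ofReal]
  rw [← ENNReal.ofReal_mul (sq_nonneg _), ← ENNReal.ofReal_mul (sq_nonneg _),
    ← ENNReal.ofReal_add (by positivity) (by positivity),
    ENNReal.ofReal_le_ofReal_iff (by positivity)]

theorem HasRelBound.mono {V : (sqrtOp G).domain →ₗ[ℂ] K} {a b b' : ℝ} (h : HasRelBound G V a b)
    (hb : 0 ≤ b) (hbb' : b ≤ b') : HasRelBound G V a b' := fun φ =>
  (h φ).trans (by gcongr)

theorem isRelInfinitesimal_iff {V : (sqrtOp G).domain →ₗ[ℂ] K} :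
    IsRelInfinitesimal G V ↔ ∀ b : ℝ, 0 < b → ∃ a : ℝ, 0 ≤ a ∧ HasRelBound G V a b := by
  constructor
  · rintro ⟨⟨a, b, ha, hb, hab⟩, h0⟩ c hc
    obtain ⟨b', ⟨hb', a', ha', h'⟩, hlt⟩ := exists_lt_of_csInf_lt
      (s := {b : ℝ | 0 ≤ b ∧ ∃ a : ℝ, 0 ≤ a ∧ HasRelBound G V a b}) ⟨b, hb, a, ha, hab⟩
      (show relBound G V < c by rwa [h0])
    exact ⟨a', ha', h'.mono hb' hlt.le⟩
  · intro h
    obtain ⟨a, ha, hab⟩ := h 1 one_pos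
    refine ⟨⟨a, 1, ha, zero_le_one, hab⟩, le_antisymm (le_of_forall_pos_le_add fun ε hε => ?_)
      (Real.sInf_nonneg fun b hb => hb.1)⟩
    rw [zero_add]
    exact csInf_le ⟨0, fun b hb => hb.1⟩ ⟨hε.le, h ε hε⟩

theorem separableSpace_of_hilbertBasis {ι : Type*} [Countable ι] (e : HilbertBasis ι ℂ L) :
    TopologicalSpace.SeparableSpace L := by
  rw [← TopologicalSpace.isSeparable_univ_iff]
  have h := ((Set.countable_range e).isSeparable.span (R := ℂ)).closure
  rwa [← Submodule.topologicalClosure_coe, e.dense_span] at h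

variable [CompleteSpace K] [CompleteSpace L]

/-- The Kraus operator `(I ⊗ ⟨eₖ|) V` of a Stinespring operator `V`, for the fixed orthonormal
basis `(eₖ)` of the environment `L`. -/
noncomputable def krausOp (V : (sqrtOp G).domain →ₗ[ℂ] HTensor K L) (k : BasisIndex L) :
    (sqrtOp G).domain →ₗ[ℂ] K :=
  (ContinuousLinearMap.adjoint (tensorRight K (onb L k)) : HTensor K L →ₗ[ℂ] K) ∘ₗ V

theorem tsum_enorm_krausOp_sq (V : (sqrtOp G).domain →ₗ[ℂ] HTensor K L) (φ : (sqrtOp G).domain) :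
    ∑' k, ‖krausOp V k φ‖ₑ ^ 2 = ‖V φ‖ₑ ^ 2 :=
  tsum_enorm_adjoint_tensorRight_sq (onb L) (V φ)

theorem HasRelBound.krausOp {V : (sqrtOp G).domain →ₗ[ℂ] HTensor K L} {a b : ℝ}
    (h : HasRelBound G V a b) (k : BasisIndex L) : HasRelBound G (krausOp V k) a b := by
  rw [hasRelBound_iff_enorm] at h ⊢
  intro φ
  refine le_trans ?_ (h φ)
  rw [← tsum_enorm_krausOp_sq]
  exact ENNReal.le_tsum (f := fun k => ‖ECD.krausOp V k φ‖ₑ ^ 2) k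

variable [TopologicalSpace.SeparableSpace H]

theorem IsRepresenting.isKraus (hG : IsPosSelfAdjoint G) {Φ : EnergyMap G K}
    {L : Type} [NormedAddCommGroup L] [InnerProductSpace ℂ L] [CompleteSpace L]
    {V : (sqrtOp G).domain →ₗ[ℂ] HTensor K L} (hV : IsRelBounded G V)
    (hVk : ∀ k, IsRelBounded G (krausOp V k)) (h : IsRepresenting G Φ V) :
    IsKraus G Φ (krausOp V) := by
  intro ρ hρ
  have ht := hρ.1.posTrace_ne_top
  have hE := hρ.2.ne
  obtain ⟨φ, hφ⟩ := exists_decomposition_of_energy_ne_top hG hρ.1.1 ht hE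
  have hs := hasSum_sandwich hG hV hφ ht hE
  have hfin : ∑' i, ‖V (φ i)‖ₑ ^ 2 ≠ ⊤ := hV.tsum_ne_top
    (by rwa [← posTrace_of_hasSum hφ]) (by rwa [← energy_of_hasSum hG hφ])
  have hk := fun k => hasSum_sandwich hG (hVk k) hφ ht hE
  have hp := hasSum_partialTrace (onb L) hs (by rwa [posTrace_of_hasSum hs])
  rw [← h ρ hρ] at hp
  have hΦ : HasSum (fun k => sandwich G (krausOp V k) ρ)
      (Φ ⟨ρ, Submodule.subset_span hρ⟩ : K →L[ℂ] K) :=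
    ((Equiv.prodComm _ _).hasSum_iff.2 hp).prod_fiberwise fun k => hk k
  have hfin' : ∑' k, ∑' i, ‖krausOp V k (φ i)‖ₑ ^ 2 ≠ ⊤ := by
    rw [ENNReal.tsum_comm]
    simpa only [tsum_enorm_krausOp_sq] using hfin
  -- the remainder of the series is positive, so its trace norm is the tail of a convergent series
  have htail : ∀ s : Finset (BasisIndex L),
      traceNorm ((Φ ⟨ρ, Submodule.subset_span hρ⟩ : K →L[ℂ] K) -
        ∑ k ∈ s, sandwich G (krausOp V k) ρ) =
      ∑' k : {k // k ∉ s}, ∑' i, ‖krausOp V k (φ i)‖ₑ ^ 2 := by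
    intro s
    have hprod : ∑' p : {k // k ∉ s} × ℕ, ‖krausOp V p.1 (φ p.2)‖ₑ ^ 2 =
        ∑' k : {k // k ∉ s}, ∑' i, ‖krausOp V k (φ i)‖ₑ ^ 2 :=
      ENNReal.tsum_prod' (f := fun p : {k // k ∉ s} × ℕ => ‖krausOp V p.1 (φ p.2)‖ₑ ^ 2)
    have hle : ∑' k : {k // k ∉ s}, ∑' i, ‖krausOp V k (φ i)‖ₑ ^ 2 ≤
        ∑' k, ∑' i, ‖krausOp V k (φ i)‖ₑ ^ 2 :=
      ENNReal.tsum_comp_le_tsum_of_injective Subtype.val_injective _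
    obtain ⟨τ, hτ⟩ := summable_rankOne
      (ψ := fun p : {k // k ∉ s} × ℕ => krausOp V p.1 (φ p.2))
      (by rw [hprod]; exact ne_top_of_le_ne_top hfin' hle)
    have h1 := hτ.prod_fiberwise fun k => hk k
    have h2 := (s.hasSum_compl_iff (f := fun k => sandwich G (krausOp V k) ρ)).1 h1
    rw [← eq_sub_of_add_eq (h2.unique hΦ), traceNorm_of_hasSum hτ, hprod]
  simp only [htail]
  exact ENNReal.tendsto_tsum_compl_atTop_zero hfin'

theorem krausNorm_krausOp_le (hG : IsPosSelfAdjoint G)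
    {L : Type} [NormedAddCommGroup L] [InnerProductSpace ℂ L] [CompleteSpace L]
    {V : (sqrtOp G).domain →ₗ[ℂ] HTensor K L} (hVk : ∀ k, IsRelBounded G (krausOp V k))
    {a b : ℝ} (h : HasRelBound G V a b) (E : ℝ) :
    krausNorm G (krausOp V) E ≤
      ENNReal.ofReal (a ^ 2) + ENNReal.ofReal (b ^ 2) * ENNReal.ofReal E := by
  refine krausNorm_le hG hVk fun φ h1 h2 => ?_
  rw [ENNReal.tsum_comm]
  simp only [tsum_enorm_krausOp_sq]
  refine (ENNReal.tsum_le_tsum fun i => hasRelBound_iff_enorm.1 h (φ i)).trans ?_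
  rw [ENNReal.tsum_add, ENNReal.tsum_mul_left, ENNReal.tsum_mul_left, h1, mul_one]
  gcongr

/-- The Stinespring operator `φ ↦ ∑ₖ Vₖ φ ⊗ eₖ` of a Kraus family `(Vₖ)`. Its relative bounds come
from the linear growth of the Kraus norm in the energy. -/
theorem IsKraus.exists_isRepresenting (hG : IsPosSelfAdjoint G) (hG0 : HasZeroInf G)
    {V : κ → (sqrtOp G).domain →ₗ[ℂ] K} (hV : ∀ k, IsRelBounded G (V k)) {Φ : EnergyMap G K}
    (hK : IsKraus G Φ V) (e : HilbertBasis κ ℂ L) {E₀ : ℝ} (hE₀ : 0 < E₀)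
    (hfin : krausNorm G V E₀ < ⊤) :
    ∃ W : (sqrtOp G).domain →ₗ[ℂ] HTensor K L, IsRepresenting G Φ W ∧
      ∀ E : ℝ, 0 < E → HasRelBound G W √(krausNorm G V E).toReal
        √(2 * (krausNorm G V E).toReal / E) := by
  have hfinE := krausNorm_lt_top hG hG0 hV hE₀ hfin
  obtain ⟨W, hW⟩ := exists_linearMap_tensor e V fun φ => by
    refine ne_top_of_le_ne_top ?_ (tsum_enorm_sq_le_add hG hG0 hV hE₀ φ)
    have := hfin.ne
    finiteness
  have hWn : ∀ φ, ‖W φ‖ₑ ^ 2 = ∑' k, ‖V k φ‖ₑ ^ 2 := fun φ => by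
    simp only [← tsum_enorm_adjoint_tensorRight_sq e, hW]
  have hbound : ∀ E : ℝ, 0 < E → HasRelBound G W √(krausNorm G V E).toReal
      √(2 * (krausNorm G V E).toReal / E) := by
    intro E hE
    rw [hasRelBound_iff_enorm]
    intro φ
    rw [hWn, Real.sq_sqrt ENNReal.toReal_nonneg, Real.sq_sqrt (by positivity),
      ENNReal.ofReal_toReal (hfinE E).ne, mul_div_right_comm, ENNReal.ofReal_mul (by positivity),
      ENNReal.ofReal_toReal (hfinE E).ne]
    exact tsum_enorm_sq_le_add hG hG0 hV hE φ
  have hWb : IsRelBounded G W :=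
    ⟨_, _, Real.sqrt_nonneg _, Real.sqrt_nonneg _, hbound E₀ hE₀⟩
  refine ⟨W, fun ρ hρ => ?_, hbound⟩
  have ht := hρ.1.posTrace_ne_top
  have hE := hρ.2.ne
  obtain ⟨φ, hφ⟩ := exists_decomposition_of_energy_ne_top hG hρ.1.1 ht hE
  have hs := hasSum_sandwich hG hWb hφ ht hE
  have hp := hasSum_partialTrace e hs (by
    rw [posTrace_of_hasSum hs]
    exact hWb.tsum_ne_top (by rwa [← posTrace_of_hasSum hφ]) (by rwa [← energy_of_hasSum hG hφ]))
  simp only [hW] at hp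
  obtain ⟨_, hΦ⟩ := hK.hasSum hG hV hρ.1.1 ht hE
  exact hΦ.unique (((Equiv.prodComm _ _).hasSum_iff.2 hp).prod_fiberwise fun k =>
    hasSum_sandwich hG (hV k) hφ ht hE)

theorem inCone_iff (hG : IsPosSelfAdjoint G) (hG0 : HasZeroInf G) (Φ : EnergyMap G K) :
    InCone G Φ ↔ ∃ (κ : Type) (_ : Countable κ) (V : κ → (sqrtOp G).domain →ₗ[ℂ] K),
      (∀ k, IsRelBounded G (V k)) ∧ IsKraus G Φ V ∧ ∃ E : ℝ, 0 < E ∧ krausNorm G V E < ⊤ := by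
  constructor
  · rintro ⟨L, _, _, _, _, V, hV, hΦ⟩
    obtain ⟨a, b, ha, hb, hab⟩ := hV
    have hVk : ∀ k, IsRelBounded G (krausOp V k) := fun k => ⟨a, b, ha, hb, hab.krausOp k⟩
    refine ⟨BasisIndex L, inferInstance, krausOp V, hVk,
      hΦ.isKraus hG ⟨a, b, ha, hb, hab⟩ hVk, 1, one_pos, ?_⟩
    exact (krausNorm_krausOp_le hG hVk hab 1).trans_lt (by finiteness)
  · rintro ⟨κ, _, V, hV, hK, E, hE, hfin⟩
    let e : HilbertBasis κ ℂ (lp (fun _ : κ => ℂ) 2) := ⟨.refl ℂ _⟩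
    obtain ⟨W, hW, hb⟩ := hK.exists_isRepresenting hG hG0 hV e hE hfin
    exact ⟨lp (fun _ : κ => ℂ) 2, inferInstance, inferInstance, inferInstance,
      separableSpace_of_hilbertBasis e, W,
      ⟨_, _, Real.sqrt_nonneg _, Real.sqrt_nonneg _, hb E hE⟩, hW⟩

theorem inConeZero_iff (hG : IsPosSelfAdjoint G) (hG0 : HasZeroInf G) (Φ : EnergyMap G K) :
    InConeZero G Φ ↔ ∃ (κ : Type) (_ : Countable κ) (V : κ → (sqrtOp G).domain →ₗ[ℂ] K),
      (∀ k, IsRelInfinitesimal G (V k)) ∧ IsKraus G Φ V ∧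
      Tendsto (fun E : ℝ => krausNorm G V E / ENNReal.ofReal E) atTop (𝓝 0) := by
  constructor
  · rintro ⟨L, _, _, _, _, V, hV, hΦ⟩
    have hV' := isRelInfinitesimal_iff.1 hV
    have hVk : ∀ k, IsRelInfinitesimal G (krausOp V k) := fun k =>
      isRelInfinitesimal_iff.2 fun b hb => (hV' b hb).imp fun a ha => ⟨ha.1, ha.2.krausOp k⟩
    refine ⟨BasisIndex L, inferInstance, krausOp V, hVk,
      hΦ.isKraus hG hV.1 fun k => (hVk k).1, ?_⟩
    rw [ENNReal.tendsto_nhds_zero]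
    intro ε hε
    obtain ⟨δ, hδ, hδε⟩ := ENNReal.lt_iff_exists_nnreal_btwn.1 hε
    have hδ0 : (0 : ℝ) < δ := by exact_mod_cast hδ
    obtain ⟨a, -, hab⟩ := hV' √(δ / 2) (by positivity)
    filter_upwards [eventually_gt_atTop 0, eventually_ge_atTop (2 * a ^ 2 / δ)] with E hE0 hE
    refine le_trans ?_ hδε.le
    refine ENNReal.div_le_of_le_mul ((krausNorm_krausOp_le hG (fun k => (hVk k).1) hab E).trans ?_)
    rw [Real.sq_sqrt (by positivity), ← ENNReal.ofReal_mul (by positivity),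
      ← ENNReal.ofReal_add (by positivity) (by positivity), ← ENNReal.ofReal_coe_nnreal,
      ← ENNReal.ofReal_mul (by positivity)]
    refine ENNReal.ofReal_le_ofReal ?_
    rw [div_le_iff₀ hδ0] at hE
    linarith
  · rintro ⟨κ, _, V, hV, hK, hlim⟩
    have hex : ∀ b : ℝ, 0 < b →
        ∃ E : ℝ, 0 < E ∧ krausNorm G V E ≤ ENNReal.ofReal (b ^ 2 / 2 * E) := by
      intro b hb
      obtain ⟨E, hE0, hE⟩ := ((eventually_gt_atTop 0).and (ENNReal.tendsto_nhds_zero.1 hlim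
        (ENNReal.ofReal (b ^ 2 / 2)) (by simpa using by positivity))).exists
      refine ⟨E, hE0, ?_⟩
      rw [ENNReal.ofReal_mul (by positivity)]
      exact (ENNReal.div_le_iff (by simpa using hE0) ENNReal.ofReal_ne_top).1 hE
    obtain ⟨E₀, hE₀, hfin⟩ := hex 1 one_pos
    let e : HilbertBasis κ ℂ (lp (fun _ : κ => ℂ) 2) := ⟨.refl ℂ _⟩
    obtain ⟨W, hW, hWb⟩ := hK.exists_isRepresenting hG hG0 (fun k => (hV k).1) e hE₀
      (hfin.trans_lt ENNReal.ofReal_lt_top)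
    refine ⟨lp (fun _ : κ => ℂ) 2, inferInstance, inferInstance, inferInstance,
      separableSpace_of_hilbertBasis e, W, isRelInfinitesimal_iff.2 fun b hb => ?_, hW⟩
    obtain ⟨E, hE, hEb⟩ := hex b hb
    refine ⟨_, Real.sqrt_nonneg _, (hWb E hE).mono (Real.sqrt_nonneg _) ?_⟩
    have h1 := ENNReal.toReal_le_of_le_ofReal (by positivity) hEb
    rw [Real.sqrt_le_left hb.le, div_le_iff₀ hE]
    linarith

end Cone

end ECD

theorem proposition3 {A : Type*} [NormedAddCommGroup A] [InnerProductSpace ℂ A] [CompleteSpace A]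
    [TopologicalSpace.SeparableSpace A]
    {B : Type*} [NormedAddCommGroup B] [InnerProductSpace ℂ B] [CompleteSpace B]
    [TopologicalSpace.SeparableSpace B]
    (G : A →ₗ.[ℂ] A) (hG : IsPosSelfAdjoint G) (hG0 : HasZeroInf G)
    (Φ : EnergyMap G B) :
    (InCone G Φ ↔
      ∃ (κ : Type) (_ : Countable κ) (V : κ → (sqrtOp G).domain →ₗ[ℂ] B),
        (∀ k, IsRelBounded G (V k)) ∧ IsKraus G Φ V ∧ ∃ E : ℝ, 0 < E ∧ krausNorm G V E < ⊤) ∧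
    (∀ (κ : Type) [Countable κ] (V : κ → (sqrtOp G).domain →ₗ[ℂ] B),
      (∀ k, IsRelBounded G (V k)) → IsKraus G Φ V → (∃ E : ℝ, 0 < E ∧ krausNorm G V E < ⊤) →
      ∀ (R : Type*) [NormedAddCommGroup R] [InnerProductSpace ℂ R] [CompleteSpace R]
        [TopologicalSpace.SeparableSpace R] [Nontrivial R],
        (∀ ω : HTensor A R →L[ℂ] HTensor A R, IsState ω → energy G (partialTrace ω) < ⊤ →
          ∃! T : HTensor B R →L[ℂ] HTensor B R, IsAmplification G Φ ω T) ∧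
        ∀ E : ℝ, 0 < E → krausNorm G V E = ecdNorm G Φ R E ∧ krausNorm G V E < ⊤) ∧
    (InConeZero G Φ ↔
      ∃ (κ : Type) (_ : Countable κ) (V : κ → (sqrtOp G).domain →ₗ[ℂ] B),
        (∀ k, IsRelInfinitesimal G (V k)) ∧ IsKraus G Φ V ∧
        Tendsto (fun E : ℝ => krausNorm G V E / ENNReal.ofReal E) atTop (𝓝 0)) := by
  refine ⟨inCone_iff hG hG0 Φ, ?_, inConeZero_iff hG hG0 Φ⟩
  rintro κ _ V hV hK ⟨E₀, hE₀, hfin⟩ R _ _ _ _ _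
  refine ⟨fun ω hω hE => ?_, fun E _ => ⟨krausNorm_eq_ecdNorm hG hG0 hV hK hE₀ hfin E,
    krausNorm_lt_top hG hG0 hV hE₀ hfin E⟩⟩
  obtain ⟨T, hT, -⟩ := exists_isAmplification_of_isState hG hG0 hV hK hE₀ hfin hω hE
  exact ⟨T, hT, fun T' hT' => hT'.unique hT⟩
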